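/- **Setting.** There are finitely many arms $a\in\{1,\dots,K\}$. The system observes features $\mathbf v_a\in\mathbb R^{d_v}$, which span $\mathbb R^{d_v}$; the user observes features $\mathbf x_a=P\mathbf v_a\in\mathbb R^{d_x}$ for a matrix $P\in\mathbb R^{d_x\times d_v}$. In round $t=1,2,\dots$ an arm $a_t$ is pulled and the reward $r_t=\mathbf x_{a_t}^{\mathsf T}\boldsymbol\theta_x^*+\eta_t=\mathbf v_{a_t}^{\mathsf T}\boldsymbol\theta_v^*+\eta_t$ is observed, where $\boldsymbol\theta_v^*=P^{\mathsf T}\boldsymbol\theta_x^*$ and the noise $\eta_t$ is independent of the past and of $a_t$, with law $\mathcal N(0,\sigma^2)$, $\sigma>0$. Let $\Delta_a=\max_i\mathbf v_i^{\mathsf T}\boldsymbol\theta_v^*-\mathbf v_a^{\mathsf T}\boldsymbol\theta_v^*$. The system's algorithm is a (possibly randomized) rule that selects $a_t$ from the previously pulled arms and observed rewards. It is *consistent* if, for every parameter $\boldsymbol\theta\in\mathbb R^{d_v}$, its expected cumulative regret over $T$ rounds in the bandit with mean rewards $\mathbf v_a^{\mathsf T}\boldsymbol\theta$ (and the same noise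 law) is $o(T^p)$ as $T\to\infty$ for all $0<p\le 1$. The user has a least squares estimator: before round $t$ the estimate $\hat{\boldsymbol\theta}_{x,t}$ minimizes $\sum_{s<t}(r_s-\mathbf x_{a_s}^{\mathsf T}\boldsymbol\theta)^2+\lambda\|\boldsymbol\theta\|_2^2$ for a fixed $\lambda\ge 0$ (ridge regression if $\lambda>0$; any minimizer is allowed if $\lambda=0$). The system offers random compensations $c_{i,t}\ge 0$, and the user is incentivized to follow the algorithm: almost surely, in every round, $$a_t\in\operatorname*{arg\,max}_i\big(\mathbf x_i^{\mathsf T}\hat{\boldsymbol\theta}_{x,t}+c_{i,t}\big).$$ The total compensation is $C(T)=\sum_{t=1}^T\mathbb E[c_{a_t,t}]\in[0,\infty]$. **Statement.** For every $\sigma>0$ there is a constant $\kappa>0$, depending only on $\sigma$, such that the following holds for all $K,d_v,d_x$, all features $\mathbf v_a$ spanning $\mathbb R^{d_v}$, all $P$, $\boldsymbol\theta_x^*$ and $\lambda\ge0$, every consistent algorithm, and all compensations as above. 1. For all sufficiently large $T$, $C(T)\ge\kappa\, c_v(\mathcal A,\boldsymbol\theta^*)\log T$, where $$c_v(\mathcal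 A,\boldsymbol\theta^*)=\inf_{\alpha}\ \sum_a\alpha_a\frac{\Delta_a}{3}$$ over all $\alpha\in[0,\infty)^K$ for which $H_v(\alpha)=\sum_a\alpha_a\mathbf v_a\mathbf v_a^{\mathsf T}$ is invertible and $\mathbf v_a^{\mathsf T}H_v(\alpha)^{-1}\mathbf v_a\le\Delta_a^2/2$ for every $a$ with $\Delta_a>0$. 2. In the $K$-armed case, where $K=d_v\ge2$, $\mathbf v_a=e_a$ are the standard basis vectors and the best arm is unique, for all sufficiently large $T$ $$C(T)\ge\kappa\,\frac{d_v\log T}{\max_a\Delta_a}.$$ ("Sufficiently large" may depend on everything except $T$.) -/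

import Mathlib

open MeasureTheory ProbabilityTheory Filter Topology Asymptotics
open scoped NNReal ENNReal Matrix

noncomputable section

namespace InfoGap

/-- A (possibly randomized) sequential arm-selection rule for `K` arms: a law for the first arm and,
for each `n`, a Markov kernel giving the arm of round `n + 1` from the arms pulled and the
rewards observed in rounds `0, …, n`. -/
structure Policy (K : ℕ) where
  init : Measure (Fin K)
  next : (n : ℕ) → Kernel (Finset.Iic n → Fin K × ℝ) (Fin K)
  [isProb_init : IsProbabilityMeasure init]
  [isMarkov_next : ∀ n, IsMarkovKernel (next n)]

attribute [instance] Policy.isProb_init Policy.isMarkov_next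

/-- Given the pulled arm `a`, the reward is `mean a` plus centred Gaussian noise of variance
`σ2`. -/
def rewardKernel {K : ℕ} (mean : Fin K → ℝ) (σ2 : ℝ≥0) : Kernel (Fin K) ℝ :=
  Kernel.ofFunOfCountable fun a => gaussianReal (mean a) σ2

instance {K : ℕ} (mean : Fin K → ℝ) (σ2 : ℝ≥0) : IsMarkovKernel (rewardKernel mean σ2) :=
  ⟨fun a => by
    change IsProbabilityMeasure (gaussianReal (mean a) σ2)
    infer_instance⟩

/-- The law of the whole sequence of pairs (pulled arm, observed reward) when arms are selected
by `π` and rewards are generated by `rewardKernel mean σ2`. -/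
def Policy.law {K : ℕ} (π : Policy K) (mean : Fin K → ℝ) (σ2 : ℝ≥0) :
    Measure (ℕ → Fin K × ℝ) :=
  Kernel.trajMeasure (X := fun _ => Fin K × ℝ)
    (π.init ⊗ₘ rewardKernel mean σ2)
    (fun n => π.next n ⊗ₖ Kernel.prodMkLeft _ (rewardKernel mean σ2))

/-- The reward gap `Δ_a` of arm `a` to the best arm. -/
def gap {K : ℕ} (mean : Fin K → ℝ) (a : Fin K) : ℝ := (⨆ i, mean i) - mean a

/-- The expected cumulative regret after `T` rounds. -/
def Policy.regret {K : ℕ} (π : Policy K) (mean : Fin K → ℝ) (σ2 : ℝ≥0) (T : ℕ) : ℝ :=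
  ∑ t ∈ Finset.range T, ∫ h, gap mean (h t).1 ∂(π.law mean σ2)

/-- The policy, which works with the features `v`, is consistent: for every parameter `θ`, its
regret in the linear bandit with mean rewards `v_aᵀ θ` is `o(T ^ p)` for all `0 < p ≤ 1`. -/
def Policy.IsConsistent {K d : ℕ} (π : Policy K) (v : Fin K → Fin d → ℝ) (σ2 : ℝ≥0) : Prop :=
  ∀ θ : Fin d → ℝ, ∀ p : ℝ, 0 < p → p ≤ 1 →
    (fun T : ℕ => π.regret (fun a => v a ⬝ᵥ θ) σ2 T) =o[atTop] fun T : ℕ => (T : ℝ) ^ p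

/-- `θhat` is a (ridge-regularized, with weight `lam`) least squares estimate from the
observations of the rounds `s < t` of `h`, with arm features `x`. For `lam > 0` it is the ridge
estimate `(lam I + ∑ x xᵀ)⁻¹ ∑ r x`; for `lam = 0` it is any ordinary least squares estimate. -/
def IsLeastSquares {K d : ℕ} (lam : ℝ) (x : Fin K → Fin d → ℝ) (h : ℕ → Fin K × ℝ) (t : ℕ)
    (θhat : Fin d → ℝ) : Prop :=
  ∀ θ : Fin d → ℝ,
    ∑ s ∈ Finset.range t, ((h s).2 - x (h s).1 ⬝ᵥ θhat) ^ 2 + lam * (θhat ⬝ᵥ θhat) ≤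
      ∑ s ∈ Finset.range t, ((h s).2 - x (h s).1 ⬝ᵥ θ) ^ 2 + lam * (θ ⬝ᵥ θ)

/-- An interaction in which the user is incentivized to follow the policy `π`. Here `h ω t` is the
pair (pulled arm, reward) of round `t`, `θhat t ω` the user's estimate before round `t`, computed
from the user's features `x`, and `c t ω i` the compensation offered for arm `i` in round `t`. -/
structure IsIncentivizedRun {K d : ℕ} {Ω : Type*} [MeasurableSpace Ω] (μ : Measure Ω)
    (π : Policy K) (x : Fin K → Fin d → ℝ) (θ : Fin d → ℝ) (σ2 : ℝ≥0) (lam : ℝ)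
    (h : Ω → ℕ → Fin K × ℝ) (θhat : ℕ → Ω → Fin d → ℝ) (c : ℕ → Ω → Fin K → ℝ) : Prop where
  measurable_run : Measurable h
  /-- arms are selected by `π`, and rewards have mean `x_aᵀ θ` -/
  law_run : μ.map h = π.law (fun a => x a ⬝ᵥ θ) σ2
  measurable_comp : ∀ t, Measurable (c t)
  comp_nonneg : ∀ᵐ ω ∂μ, ∀ t i, 0 ≤ c t ω i
  least_squares : ∀ᵐ ω ∂μ, ∀ t, IsLeastSquares lam x (h ω) t (θhat t ω)
  /-- the pulled arm maximizes the user's estimated reward plus compensation -/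
  user_choice : ∀ᵐ ω ∂μ, ∀ t i,
    x i ⬝ᵥ θhat t ω + c t ω i ≤ x (h ω t).1 ⬝ᵥ θhat t ω + c t ω (h ω t).1

/-- The total compensation `C(T) = ∑_{t} 𝔼[c_{a_t,t}]` of the first `T` rounds, possibly
infinite. -/
def totalCompensation {K : ℕ} {Ω : Type*} [MeasurableSpace Ω] (μ : Measure Ω)
    (h : Ω → ℕ → Fin K × ℝ) (c : ℕ → Ω → Fin K → ℝ) (T : ℕ) : ℝ≥0∞ :=
  ∑ t ∈ Finset.range T, ∫⁻ ω, ENNReal.ofReal (c t ω (h ω t).1) ∂μ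

/-- `H(α) = ∑_a α_a v_a v_aᵀ`. -/
def designMatrix {K d : ℕ} (v : Fin K → Fin d → ℝ) (α : Fin K → ℝ) : Matrix (Fin d) (Fin d) ℝ :=
  ∑ a, α a • Matrix.vecMulVec (v a) (v a)

/-- `α ≥ 0`, `H(α)` is invertible and `‖v_a‖²_{H(α)⁻¹} ≤ Δ_a² / 2` for all suboptimal arms. -/
structure IsFeasible {K d : ℕ} (v : Fin K → Fin d → ℝ) (mean : Fin K → ℝ) (α : Fin K → ℝ) :
    Prop where
  nonneg : ∀ a, 0 ≤ α a
  posDef : (designMatrix v α).PosDef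
  width_le : ∀ a, 0 < gap mean a →
    v a ⬝ᵥ ((designMatrix v α)⁻¹ *ᵥ v a) ≤ gap mean a ^ 2 / 2

/-- The optimal value `inf ∑_a α_a Δ_a / 3` over all feasible `α`. -/
def optValue {K d : ℕ} (v : Fin K → Fin d → ℝ) (mean : Fin K → ℝ) : ℝ :=
  sInf {y | ∃ α : Fin K → ℝ, IsFeasible v mean α ∧ y = ∑ a, α a * (gap mean a / 3)}

end InfoGap

end

noncomputable section

namespace InfoGap

variable {K d : ℕ}

/-! The compensation is bounded below by counting the pulls of suboptimal arms that the user, well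
informed by then, must be paid for.

Payment. If the user's estimates of a pulled arm `b` and of some optimal arm are both within a third
of the gap of `b`, the estimated gap is at least a third of the true one, and `b` must be
compensated by that much (`gap_div_three_le`). Least squares errors are small once an arm has many
pulls relative to the noise level (`IsLeastSquares.pulls_mul_sq_le`). Ville's inequality over a
dyadic grid keeps the noise at level of order `log log T` up to time `T` with high probability
(`Policy.law_exists_sq_noiseSum`), so about `√(log T)` pulls suffice. Hence all but `o(log T)` pulls
are good (`pulls_le_card_goodPull`).

Exploration. Let `u` be orthogonal to the features of all optimal arms and raise a suboptimal arm by
twice its gap. Under `θ + u` the formerly optimal arms are suboptimal, so consistency makes the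
algorithm behave differently under `θ` and `θ + u`. A second-moment change of measure then forces
information of at least `log T / 2` with probability tending to one (`Policy.tendsto_law_infoSum`).
The expected good pulls, divided by `log T`, therefore eventually have energy at least `σ2 / 8`
along each such `u` (`Policy.eventually_energy`).

Optimization. The time from which this holds depends on `u`. Compactness of the weights of bounded
cost removes this dependence (`eventually_optValue_le`): a cluster point has the energy bound in all
confusing directions at once. Large, cost-free weights on the optimal arms and a rescaling then make
it feasible (`optValue_le_of_energy`), since a violated width constraint would yield a direction of
too little energy. -/

instance (π : Policy K) (mean : Fin K → ℝ) (σ2 : ℝ≥0) : IsProbabilityMeasure (π.law mean σ2) := by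
  unfold Policy.law
  infer_instance

/-! ### Disintegration of the bandit law, one round at a time. -/

/-- The conditional law of the arm of round `t` given the history. -/
def Policy.armKernel (π : Policy K) : ℕ → Kernel (ℕ → Fin K × ℝ) (Fin K)
  | 0 => Kernel.const _ π.init
  | n + 1 => (π.next n).comap (Preorder.frestrictLe (π := fun _ => Fin K × ℝ) n) (by fun_prop)

instance (π : Policy K) (t : ℕ) : IsMarkovKernel (π.armKernel t) := by
  cases t <;> unfold Policy.armKernel <;> infer_instance

theorem Policy.map_law_zero (π : Policy K) (mean : Fin K → ℝ) (σ2 : ℝ≥0) :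
    (π.law mean σ2).map (fun h => h 0) = π.init ⊗ₘ rewardKernel mean σ2 := by
  have h1 : (fun h : ℕ → Fin K × ℝ => h 0) =
      (MeasurableEquiv.piUnique (fun _ : Finset.Iic 0 => Fin K × ℝ)) ∘
        Preorder.frestrictLe (π := fun _ => Fin K × ℝ) 0 := by
    funext h
    rfl
  rw [h1, ← Measure.map_map (by fun_prop) (by fun_prop), Policy.law, Kernel.trajMeasure,
    Measure.map_comp _ _ (by fun_prop), Kernel.traj_map_frestrictLe, Kernel.partialTraj_self,
    Measure.id_comp, Measure.map_map (by fun_prop) (by fun_prop)]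
  exact Measure.map_id

theorem lintegral_compProd_reward {mean : Fin K → ℝ} {σ2 : ℝ≥0} (p : Measure (Fin K)) [SFinite p]
    {g : Fin K × ℝ → ℝ≥0∞} (hg : Measurable g) :
    ∫⁻ z, g z ∂(p ⊗ₘ rewardKernel mean σ2) =
      ∫⁻ a, ∫⁻ r, g (a, r) ∂gaussianReal (mean a) σ2 ∂p := by
  rw [Measure.lintegral_compProd hg]
  rfl

/-- Disintegration of the law of the history at round `t`. -/
theorem Policy.lintegral_law (π : Policy K) (mean : Fin K → ℝ) (σ2 : ℝ≥0) (t : ℕ)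
    {g : (ℕ → Fin K × ℝ) → ℝ≥0∞} (hg : Measurable g) (hd : DependsOn g (Set.Iic t)) :
    ∫⁻ h, g h ∂π.law mean σ2 =
      ∫⁻ h, ∫⁻ a, ∫⁻ r, g (Function.update h t (a, r)) ∂gaussianReal (mean a) σ2
        ∂π.armKernel t h ∂π.law mean σ2 := by
  cases t with
  | zero =>
    have h0 : ∀ h z, g (Function.update h 0 z) = g (fun _ => z) := fun h z => hd fun i hi => by
      have : i = 0 := by simpa using hi
      simp [this]
    simp only [h0]
    change _ = ∫⁻ h, ∫⁻ a, ∫⁻ r, g (fun _ => (a, r)) ∂gaussianReal (mean a) σ2 ∂π.init ∂_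
    rw [lintegral_const, measure_univ, mul_one,
      ← lintegral_compProd_reward (g := fun z => g fun _ => z) _ (by fun_prop),
      ← Policy.map_law_zero, lintegral_map (by fun_prop) (by fun_prop)]
    exact lintegral_congr fun h => hd fun i hi => by
      have : i = 0 := by simpa using hi
      rw [this]
  | succ n =>
    -- All coordinates after `n` get the new pair; the values beyond `n + 1` are irrelevant because
    -- `g` does not see them.
    let ext : (Finset.Iic n → Fin K × ℝ) × (Fin K × ℝ) → ℕ → Fin K × ℝ := fun p i =>
      if hi : i ≤ n then p.1 ⟨i, by simpa using hi⟩ else p.2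
    have hext : Measurable ext := by
      refine measurable_pi_lambda _ fun i => ?_
      by_cases hi : i ≤ n
      · simp only [ext, hi, dif_pos]; fun_prop
      · simpa only [ext, hi, dite_false] using measurable_snd
    have hG : Measurable fun p => g (ext p) := hg.comp hext
    have hupd : ∀ h z, g (Function.update h (n + 1) z) =
        g (ext (Preorder.frestrictLe (π := fun _ => Fin K × ℝ) n h, z)) := fun h z =>
      hd fun i hi => by
        by_cases hi' : i ≤ n
        · have : i ≠ n + 1 := by omega
          simp [ext, hi', this]
        · have : i = n + 1 := by have : i ≤ n + 1 := hi; omega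
          simp [ext, this]
    have hfr : Measurable (Preorder.frestrictLe (π := fun _ => Fin K × ℝ) n) := by fun_prop
    simp only [hupd]
    have key := Kernel.map_frestrictLe_trajMeasure_compProd_eq_map_trajMeasure
      (X := fun _ => Fin K × ℝ) (μ₀ := π.init ⊗ₘ rewardKernel mean σ2)
      (κ := fun n => π.next n ⊗ₖ Kernel.prodMkLeft _ (rewardKernel mean σ2)) (a := n)
    have h1 : ∫⁻ h, g h ∂π.law mean σ2 =
        ∫⁻ p, g (ext p) ∂((π.law mean σ2).map
          (fun x => (Preorder.frestrictLe (π := fun _ => Fin K × ℝ) n x, x (n + 1)))) := by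
      rw [lintegral_map hG (by fun_prop)]
      refine lintegral_congr fun h => ?_
      rw [← hupd, Function.update_eq_self]
    rw [h1]
    unfold Policy.law
    rw [← key, Measure.lintegral_compProd hG, lintegral_map ?_ hfr]
    · refine lintegral_congr fun h => ?_
      rw [Kernel.lintegral_compProd _ _ _ (by fun_prop)]
      rfl
    · exact Measurable.lintegral_kernel_prod_right' hG

theorem Policy.measurable_step (π : Policy K) (mean : Fin K → ℝ) (σ2 : ℝ≥0) (t : ℕ)
    {g : (ℕ → Fin K × ℝ) → ℝ≥0∞} (hg : Measurable g) :
    Measurable fun h => ∫⁻ a, ∫⁻ r, g (Function.update h t (a, r)) ∂gaussianReal (mean a) σ2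
        ∂π.armKernel t h := by
  have h1 : Measurable fun p : ((ℕ → Fin K × ℝ) × Fin K) × ℝ =>
      g (Function.update p.1.1 t (p.1.2, p.2)) := by
    refine hg.comp (measurable_pi_lambda _ fun i => ?_)
    by_cases hi : i = t
    · subst hi; simp only [Function.update_self]; fun_prop
    · simp only [Function.update_of_ne hi]; fun_prop
  have h2 : Measurable fun p : (ℕ → Fin K × ℝ) × Fin K =>
      ∫⁻ r, g (Function.update p.1 t (p.2, r)) ∂gaussianReal (mean p.2) σ2 :=
    Measurable.lintegral_kernel_prod_right' (κ := Kernel.prodMkLeft _ (rewardKernel mean σ2)) h1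
  exact Measurable.lintegral_kernel_prod_right' h2

theorem Policy.dependsOn_armKernel (π : Policy K) (t : ℕ) :
    DependsOn (fun h => π.armKernel t h) (Set.Iio t) := by
  intro h h' hh
  cases t with
  | zero => rfl
  | succ n =>
    have : Preorder.frestrictLe (π := fun _ => Fin K × ℝ) n h = Preorder.frestrictLe n h' := by
      funext i
      exact hh i (Nat.lt_succ_of_le (Finset.mem_Iic.1 i.2))
    simp only [Policy.armKernel, Kernel.comap_apply, this]

/-- Averaging out round `t` leaves a function of the earlier rounds, so inductions can strip the
last round repeatedly. -/
theorem Policy.dependsOn_step (π : Policy K) (mean : Fin K → ℝ) (σ2 : ℝ≥0) (t : ℕ)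
    {g : (ℕ → Fin K × ℝ) → ℝ≥0∞} (hd : DependsOn g (Set.Iic t)) :
    DependsOn (fun h => ∫⁻ a, ∫⁻ r, g (Function.update h t (a, r)) ∂gaussianReal (mean a) σ2
        ∂π.armKernel t h) (Set.Iio t) := by
  intro h h' hh
  have h1 : ∀ z, g (Function.update h t z) = g (Function.update h' t z) := fun z =>
    hd fun i hi => by
      by_cases hit : i = t
      · subst hit; simp
      · simp only [Function.update_of_ne hit]
        exact hh i (lt_of_le_of_ne hi hit)
  simp only [h1]
  rw [show π.armKernel t h = π.armKernel t h' from π.dependsOn_armKernel t hh]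

/-- A factor depending on the current pair, with conditional mean one, may be dropped. -/
theorem Policy.lintegral_law_mul (π : Policy K) (mean : Fin K → ℝ) (σ2 : ℝ≥0) (t : ℕ)
    {F : (ℕ → Fin K × ℝ) → ℝ≥0∞} (hF : Measurable F) (hd : DependsOn F (Set.Iio t))
    {φ : Fin K × ℝ → ℝ≥0∞} (hφ : Measurable φ)
    (h1 : ∀ a, ∫⁻ r, φ (a, r) ∂gaussianReal (mean a) σ2 = 1) :
    ∫⁻ h, F h * φ (h t) ∂π.law mean σ2 = ∫⁻ h, F h ∂π.law mean σ2 := by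
  rw [π.lintegral_law mean σ2 t (by fun_prop)]
  · refine lintegral_congr fun h => ?_
    have : ∀ z, F (Function.update h t z) = F h := fun z => hd fun i hi => by
      rw [Function.update_of_ne (ne_of_lt hi)]
    simp only [this, Function.update_self]
    have h2 : ∀ a, ∫⁻ r, F h * φ (a, r) ∂gaussianReal (mean a) σ2 = F h := fun a => by
      rw [lintegral_const_mul _ (by fun_prop), h1, mul_one]
    simp only [h2]
    simp
  · intro h h' hh
    change F h * φ (h t) = F h' * φ (h' t)
    rw [hd fun i hi => hh i (Set.mem_Iic.2 (le_of_lt hi)), hh t (Set.mem_Iic.2 le_rfl)]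

/-! ### Second-moment change of measure. -/

theorem sq_lintegral_mul_le {α : Type*} [MeasurableSpace α] (μ : Measure α) {f g : α → ℝ≥0∞}
    (hf : AEMeasurable f μ) (hg : AEMeasurable g μ) :
    (∫⁻ x, f x * g x ∂μ) ^ 2 ≤ (∫⁻ x, f x ^ 2 ∂μ) * ∫⁻ x, g x ^ 2 ∂μ := by
  have h := ENNReal.lintegral_mul_le_Lp_mul_Lq μ (p := 2) (q := 2)
    (by constructor <;> norm_num) hf hg
  calc _ ≤ _ := pow_le_pow_left' h 2
    _ = _ := by
      rw [mul_pow, ← ENNReal.rpow_natCast, ← ENNReal.rpow_natCast, ← ENNReal.rpow_mul,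
        ← ENNReal.rpow_mul]
      simp

theorem sq_lintegral_le {α : Type*} [MeasurableSpace α] (μ : Measure α) [IsProbabilityMeasure μ]
    {f : α → ℝ≥0∞} (hf : AEMeasurable f μ) :
    (∫⁻ x, f x ∂μ) ^ 2 ≤ ∫⁻ x, f x ^ 2 ∂μ := by
  simpa using sq_lintegral_mul_le μ hf (aemeasurable_const (b := 1))

/-- The normalized Gaussian moment generating function serves both the second moment of likelihood
ratios and the exponential martingales of the noise. -/
theorem lintegral_exp_gaussianReal (m : ℝ) (v : ℝ≥0) (t : ℝ) :
    ∫⁻ r, ENNReal.ofReal (Real.exp (t * (r - m) - t ^ 2 * v / 2)) ∂gaussianReal m v = 1 := by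
  have h := mgf_gaussianReal (p := gaussianReal m v) (X := id) (μ := m) (v := v) (by simp) t
  have h2 : ∀ r, Real.exp (t * (r - m) - t ^ 2 * v / 2) =
      Real.exp (-(t * m) - t ^ 2 * v / 2) * Real.exp (t * r) := fun r => by
    rw [← Real.exp_add]; ring_nf
  simp only [h2]
  rw [← ofReal_integral_eq_lintegral_ofReal
    ((integrable_exp_mul_gaussianReal t).const_mul _) (ae_of_all _ fun r => by positivity),
    integral_const_mul]
  simp only [mgf, id] at h
  rw [h, ← Real.exp_add]
  ring_nf
  simp

theorem gaussianReal_eq_withDensity_shift (m m' : ℝ) {v : ℝ≥0} (hv : v ≠ 0) :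
    gaussianReal m v = (gaussianReal m' v).withDensity fun r =>
      ENNReal.ofReal (Real.exp ((m - m') / v * (r - m') - ((m - m') / v) ^ 2 * v / 2)) := by
  rw [gaussianReal_of_var_ne_zero _ hv, gaussianReal_of_var_ne_zero _ hv,
    ← withDensity_mul _ (by fun_prop) (by fun_prop)]
  congr 1
  funext r
  simp only [Pi.mul_apply, gaussianPDF, gaussianPDFReal]
  rw [← ENNReal.ofReal_mul (by positivity), mul_assoc (√(2 * Real.pi * v))⁻¹,
    ← Real.exp_add]
  congr 3
  have : (v : ℝ) ≠ 0 := by exact_mod_cast hv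
  field_simp
  ring

/-- Second-moment change of mean for Gaussian integrals. -/
theorem sq_lintegral_gaussianReal_le (m m' : ℝ) {v : ℝ≥0} (hv : v ≠ 0) {f : ℝ → ℝ≥0∞}
    (hf : Measurable f) :
    (∫⁻ r, f r ∂gaussianReal m v) ^ 2 ≤
      ENNReal.ofReal (Real.exp ((m - m') ^ 2 / v)) * ∫⁻ r, f r ^ 2 ∂gaussianReal m' v := by
  rw [gaussianReal_eq_withDensity_shift m m' hv,
    lintegral_withDensity_eq_lintegral_mul _ (by fun_prop) hf]
  refine (sq_lintegral_mul_le _ (by fun_prop) (by fun_prop)).trans (mul_le_mul_left ?_ _)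
  have hv' : (v : ℝ) ≠ 0 := by exact_mod_cast hv
  -- With tilt `s = (m - m') / v`, the squared density is `exp (s² v)` times the density of tilt `2
  -- s`, which integrates to one.
  have h1 : ∀ r, ENNReal.ofReal
      (Real.exp ((m - m') / v * (r - m') - ((m - m') / v) ^ 2 * v / 2)) ^ 2 =
      ENNReal.ofReal (Real.exp ((m - m') ^ 2 / v)) * ENNReal.ofReal
        (Real.exp (2 * (m - m') / v * (r - m') - (2 * (m - m') / v) ^ 2 * v / 2)) := fun r => by
    rw [← ENNReal.ofReal_pow (by positivity), ← ENNReal.ofReal_mul (by positivity),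
      ← Real.exp_add, ← Real.exp_nat_mul]
    congr 2
    push_cast
    field_simp
    ring
  simp only [h1]
  rw [lintegral_const_mul _ (by fun_prop), lintegral_exp_gaussianReal, mul_one]

/-- Twice the information collected in the first `T` rounds for telling `mean` from `mean'`. -/
def infoSum (mean mean' : Fin K → ℝ) (σ2 : ℝ≥0) (T : ℕ) (h : ℕ → Fin K × ℝ) : ℝ :=
  ∑ s ∈ Finset.range T, (mean (h s).1 - mean' (h s).1) ^ 2 / σ2

@[fun_prop]
theorem measurable_infoSum (mean mean' : Fin K → ℝ) (σ2 : ℝ≥0) (T : ℕ) :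
    Measurable (infoSum mean mean' σ2 T) := by
  unfold infoSum
  refine Finset.measurable_sum _ fun s _ => ?_
  exact (measurable_of_finite fun a => (mean a - mean' a) ^ 2 / (σ2 : ℝ)).comp
    (measurable_fst.comp (measurable_pi_apply s))

theorem dependsOn_infoSum (mean mean' : Fin K → ℝ) (σ2 : ℝ≥0) (T : ℕ) :
    DependsOn (infoSum mean mean' σ2 T) (Set.Iio T) := fun h h' hh =>
  Finset.sum_congr rfl fun s hs => by rw [hh s (Finset.mem_range.1 hs)]

/-- Change of measure between two bandits with the same policy. -/
theorem Policy.sq_lintegral_law_le (π : Policy K) (mean mean' : Fin K → ℝ) {σ2 : ℝ≥0}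
    (hσ : σ2 ≠ 0) (T : ℕ) {f : (ℕ → Fin K × ℝ) → ℝ≥0∞} (hf : Measurable f)
    (hd : DependsOn f (Set.Iio T)) :
    (∫⁻ h, f h ∂π.law mean σ2) ^ 2 ≤
      ∫⁻ h, ENNReal.ofReal (Real.exp (infoSum mean mean' σ2 T h)) * f h ^ 2
        ∂π.law mean' σ2 := by
  induction T generalizing f with
  | zero =>
    have hne : Nonempty (ℕ → Fin K × ℝ) := (π.law mean σ2).nonempty_of_neZero
    obtain ⟨h₀⟩ := hne
    have : ∀ h, f h = f h₀ := fun h => hd fun i hi => absurd hi (by simp)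
    simp [this, infoSum]
  | succ T ih =>
    have hd' : DependsOn f (Set.Iic T) := fun h h' hh =>
      hd fun i hi => hh i (Nat.lt_succ_iff.1 hi)
    have hD : DependsOn (fun h => ENNReal.ofReal (Real.exp (infoSum mean mean' σ2 (T + 1) h)) *
        f h ^ 2) (Set.Iic T) := fun h h' hh => by
      simp only [hd' hh, dependsOn_infoSum mean mean' σ2 (T + 1)
        fun i hi => hh i (Nat.lt_succ_iff.1 hi)]
    rw [π.lintegral_law mean σ2 T hf hd', π.lintegral_law mean' σ2 T (by fun_prop) hD]
    refine (ih (π.measurable_step mean σ2 T hf) (π.dependsOn_step mean σ2 T hd')).trans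
      (lintegral_mono fun h => ?_)
    have hupd : Measurable fun p : Fin K × ℝ => Function.update h T p := by fun_prop
    have hfu : ∀ a, Measurable fun r => f (Function.update h T (a, r)) := fun a =>
      hf.comp (hupd.comp (by fun_prop))
    have hinfo : ∀ a r, infoSum mean mean' σ2 (T + 1) (Function.update h T (a, r)) =
        infoSum mean mean' σ2 T h + (mean a - mean' a) ^ 2 / σ2 := fun a r => by
      rw [infoSum, Finset.sum_range_succ, Function.update_self]
      congr 1
      exact dependsOn_infoSum mean mean' σ2 T fun i hi => by
        rw [Function.update_of_ne (ne_of_lt hi)]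
    -- The arm kernel is common to both bandits, so averaging over the arm costs only Jensen; the
    -- exponential factor comes from the reward alone.
    calc _ ≤ ENNReal.ofReal (Real.exp (infoSum mean mean' σ2 T h)) *
          ∫⁻ a, (∫⁻ r, f (Function.update h T (a, r)) ∂gaussianReal (mean a) σ2) ^ 2
            ∂π.armKernel T h := by
          gcongr
          exact sq_lintegral_le _ (measurable_of_finite _).aemeasurable
      _ ≤ ENNReal.ofReal (Real.exp (infoSum mean mean' σ2 T h)) *
          ∫⁻ a, ENNReal.ofReal (Real.exp ((mean a - mean' a) ^ 2 / σ2)) *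
            ∫⁻ r, f (Function.update h T (a, r)) ^ 2 ∂gaussianReal (mean' a) σ2
            ∂π.armKernel T h := by
          gcongr with a
          exact sq_lintegral_gaussianReal_le _ _ hσ (hfu a)
      _ = _ := by
          rw [← lintegral_const_mul _ (measurable_of_finite _)]
          refine lintegral_congr fun a => ?_
          simp only [hinfo]
          rw [lintegral_const_mul _ ((hfu a).pow_const 2), ← mul_assoc,
            ← ENNReal.ofReal_mul (by positivity), ← Real.exp_add]

/-! ### Pull counts and time-uniform noise control. -/

/-- The number of pulls of arm `b` in the first `t` rounds. -/
def pulls (b : Fin K) (t : ℕ) (h : ℕ → Fin K × ℝ) : ℕ :=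
  ∑ s ∈ Finset.range t, if (h s).1 = b then 1 else 0

/-- The sum of the noise terms of the pulls of arm `b` in the first `t` rounds. -/
def noiseSum (mean : Fin K → ℝ) (b : Fin K) (t : ℕ) (h : ℕ → Fin K × ℝ) : ℝ :=
  ∑ s ∈ Finset.range t, if (h s).1 = b then (h s).2 - mean b else 0

@[fun_prop]
theorem measurable_arm (s : ℕ) : Measurable fun h : ℕ → Fin K × ℝ => (h s).1 :=
  measurable_fst.comp (measurable_pi_apply s)

@[measurability]
theorem measurableSet_arm (s : ℕ) (b : Fin K) :
    MeasurableSet {h : ℕ → Fin K × ℝ | (h s).1 = b} :=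
  measurable_arm s (measurableSet_singleton b)

@[fun_prop]
theorem measurable_pulls (b : Fin K) (t : ℕ) : Measurable (pulls b t) :=
  Finset.measurable_sum _ fun s _ =>
    Measurable.ite (measurableSet_arm s b) measurable_const measurable_const

@[fun_prop]
theorem measurable_noiseSum (mean : Fin K → ℝ) (b : Fin K) (t : ℕ) :
    Measurable (noiseSum mean b t) :=
  Finset.measurable_sum _ fun s _ =>
    Measurable.ite (measurableSet_arm s b) (by fun_prop) measurable_const

theorem dependsOn_pulls (b : Fin K) (t : ℕ) : DependsOn (pulls b t) (Set.Iio t) := fun h h' hh =>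
  Finset.sum_congr rfl fun s hs => by rw [hh s (Finset.mem_range.1 hs)]

theorem dependsOn_noiseSum (mean : Fin K → ℝ) (b : Fin K) (t : ℕ) :
    DependsOn (noiseSum mean b t) (Set.Iio t) := fun h h' hh =>
  Finset.sum_congr rfl fun s hs => by rw [hh s (Finset.mem_range.1 hs)]

theorem pulls_succ (b : Fin K) (t : ℕ) (h : ℕ → Fin K × ℝ) :
    pulls b (t + 1) h = pulls b t h + if (h t).1 = b then 1 else 0 :=
  Finset.sum_range_succ _ _

theorem noiseSum_succ (mean : Fin K → ℝ) (b : Fin K) (t : ℕ) (h : ℕ → Fin K × ℝ) :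
    noiseSum mean b (t + 1) h =
      noiseSum mean b t h + if (h t).1 = b then (h t).2 - mean b else 0 :=
  Finset.sum_range_succ _ _

theorem pulls_le (b : Fin K) (t : ℕ) (h : ℕ → Fin K × ℝ) : pulls b t h ≤ t := by
  induction t with
  | zero => simp [pulls]
  | succ t ih => rw [pulls_succ]; split_ifs <;> omega

theorem sum_pulls (t : ℕ) (h : ℕ → Fin K × ℝ) : ∑ b, pulls b t h = t := by
  unfold pulls
  rw [Finset.sum_comm]
  simp

theorem noiseSum_eq_zero {mean : Fin K → ℝ} {b : Fin K} {t : ℕ} {h : ℕ → Fin K × ℝ}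
    (h0 : pulls b t h = 0) : noiseSum mean b t h = 0 := by
  refine Finset.sum_eq_zero fun s hs => if_neg fun hb => ?_
  have := (Finset.sum_eq_zero_iff.1 h0) s hs
  simp [hb] at this

/-- The exponent of the exponential martingale of the noise of arm `b`. -/
def expo (mean : Fin K → ℝ) (σ2 : ℝ≥0) (b : Fin K) (l : ℝ) (t : ℕ) (h : ℕ → Fin K × ℝ) : ℝ :=
  l * noiseSum mean b t h - l ^ 2 * σ2 / 2 * pulls b t h

@[fun_prop]
theorem measurable_expo (mean : Fin K → ℝ) (σ2 : ℝ≥0) (b : Fin K) (l : ℝ) (t : ℕ) :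
    Measurable (expo mean σ2 b l t) := by
  unfold expo
  have : Measurable fun h : ℕ → Fin K × ℝ => (pulls b t h : ℝ) :=
    measurable_from_top.comp (measurable_pulls b t)
  fun_prop

theorem dependsOn_expo (mean : Fin K → ℝ) (σ2 : ℝ≥0) (b : Fin K) (l : ℝ) (t : ℕ) :
    DependsOn (expo mean σ2 b l t) (Set.Iio t) := fun h h' hh => by
  simp only [expo, dependsOn_noiseSum mean b t hh, dependsOn_pulls b t hh]

/-- Ville's maximal inequality for the exponential martingale of one arm. -/
theorem Policy.law_exists_le_expo (π : Policy K) (mean : Fin K → ℝ) (σ2 : ℝ≥0) (b : Fin K)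
    (l u : ℝ) (T : ℕ) :
    π.law mean σ2 {h | ∃ t ≤ T, u ≤ expo mean σ2 b l t h} ≤ ENNReal.ofReal (Real.exp (-u)) := by
  set P := π.law mean σ2 with hP
  set X := expo mean σ2 b l with hX
  let A : ℕ → Set (ℕ → Fin K × ℝ) := fun T => {h | ∃ t ≤ T, u ≤ X t h}
  have hXm : ∀ t, Measurable (X t) := fun t => measurable_expo _ _ _ _ _
  have hA : ∀ T, MeasurableSet (A T) := fun T => by
    have : A T = ⋃ t ∈ Finset.range (T + 1), {h | u ≤ X t h} := by
      ext h; simp [A]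
    rw [this]
    exact Finset.measurableSet_biUnion _ fun t _ => measurableSet_le measurable_const (hXm t)
  have hAs : ∀ T, A (T + 1) = A T ∪ {h | u ≤ X (T + 1) h} := fun T => by
    ext h
    simp only [A, Set.mem_ofPred_eq, Set.mem_union, Nat.le_succ_iff]
    constructor
    · rintro ⟨t, ht | rfl, h1⟩
      · exact Or.inl ⟨t, ht, h1⟩
      · exact Or.inr h1
    · rintro (⟨t, ht, h1⟩ | h1)
      · exact ⟨t, Or.inl ht, h1⟩
      · exact ⟨T + 1, Or.inr rfl, h1⟩
  have hAd : ∀ T h h', (∀ i ∈ Set.Iio T, h i = h' i) → h ∈ A T → h' ∈ A T := by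
    rintro T h h' hh ⟨t, ht, h1⟩
    refine ⟨t, ht, h1.trans_eq ?_⟩
    exact dependsOn_expo mean σ2 b l t fun i hi => hh i (lt_of_lt_of_le hi ht)
  rcases le_or_gt u 0 with hu | hu
  · exact prob_le_one.trans (by simpa using hu)
  -- Martingale stopped at its first passage above `exp u`: paths that have crossed are counted with
  -- value `exp u`, the others with their current value. Positivity of `u` makes `A 0` empty.
  have key : ∀ T, ENNReal.ofReal (Real.exp u) * P (A T) +
      ∫⁻ h in (A T)ᶜ, ENNReal.ofReal (Real.exp (X T h)) ∂P ≤ 1 := by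
    intro T
    induction T with
    | zero =>
      have : A 0 = ∅ := by
        ext h; simp [A, hX, expo, noiseSum, pulls]; linarith
      simp [this, hX, expo, noiseSum, pulls]
    | succ T ih =>
      refine le_trans ?_ ih
      -- Not having crossed by time `T` is decided by the past, so the next factor of conditional
      -- mean one can be inserted.
      have h1 : ∫⁻ h in (A T)ᶜ, ENNReal.ofReal (Real.exp (X T h)) ∂P =
          ∫⁻ h in (A T)ᶜ, ENNReal.ofReal (Real.exp (X (T + 1) h)) ∂P := by
        rw [← lintegral_indicator (hA T).compl, ← lintegral_indicator (hA T).compl]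
        have h2 : ∀ h, (A T)ᶜ.indicator (fun h => ENNReal.ofReal (Real.exp (X (T + 1) h))) h =
            (A T)ᶜ.indicator (fun h => ENNReal.ofReal (Real.exp (X T h))) h *
              (fun z : Fin K × ℝ => if z.1 = b then
                ENNReal.ofReal (Real.exp (l * (z.2 - mean b) - l ^ 2 * σ2 / 2)) else 1) (h T) := by
          intro h
          by_cases hh : h ∈ (A T)ᶜ
          · simp only [Set.indicator_of_mem hh, hX, expo, noiseSum_succ, pulls_succ]
            split_ifs
            · rw [← ENNReal.ofReal_mul (by positivity), ← Real.exp_add]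
              push_cast
              ring_nf
            · simp
          · simp [Set.indicator_of_notMem hh]
        rw [lintegral_congr h2]
        refine (π.lintegral_law_mul mean σ2 T (φ := fun z : Fin K × ℝ => if z.1 = b then
          ENNReal.ofReal (Real.exp (l * (z.2 - mean b) - l ^ 2 * σ2 / 2)) else 1)
          ?_ ?_ ?_ fun a => ?_).symm
        · exact Measurable.indicator (by fun_prop) (hA T).compl
        · intro h h' hh
          have : h ∈ (A T)ᶜ ↔ h' ∈ (A T)ᶜ :=
            not_congr ⟨hAd T h h' hh, hAd T h' h fun i hi => (hh i hi).symm⟩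
          by_cases hm : h ∈ (A T)ᶜ
          · rw [Set.indicator_of_mem hm, Set.indicator_of_mem (this.1 hm)]
            simp only [hX, dependsOn_expo mean σ2 b l T hh]
          · rw [Set.indicator_of_notMem hm, Set.indicator_of_notMem (this.not.1 hm)]
        · refine Measurable.ite (measurable_fst (measurableSet_singleton b)) (by fun_prop)
            measurable_const
        · by_cases hab : a = b
          · subst hab
            simpa using lintegral_exp_gaussianReal (mean a) σ2 l
          · simp [hab]
      have hB : MeasurableSet {h | u ≤ X (T + 1) h} :=
        measurableSet_le measurable_const (hXm _)
      -- Paths crossing exactly at `T + 1` move to the first term, at a value not above their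
      -- current one.
      rw [h1, hAs, Set.compl_union, ← lintegral_inter_add_sdiff _ (A T)ᶜ hB,
        ← add_assoc, ← Set.sdiff_eq]
      gcongr
      calc _ ≤ ENNReal.ofReal (Real.exp u) *
            (P (A T) + P ((A T)ᶜ ∩ {h | u ≤ X (T + 1) h})) := by
            gcongr
            refine (measure_mono fun h hh => ?_).trans (measure_union_le _ _)
            by_cases hA' : h ∈ A T
            · exact Or.inl hA'
            · exact Or.inr ⟨hA', hh.resolve_left hA'⟩
        _ ≤ _ := by
            rw [mul_add]
            gcongr
            rw [← setLIntegral_const]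
            refine setLIntegral_mono (by fun_prop) fun h hh => ?_
            exact ENNReal.ofReal_le_ofReal (Real.exp_le_exp.2 hh.2)
  have h1 := le_self_add.trans (key T)
  rw [mul_comm, ← ENNReal.le_div_iff_mul_le (by simp [Real.exp_pos]) (by simp)] at h1
  refine h1.trans_eq ?_
  rw [one_div, ← ENNReal.ofReal_inv_of_pos (Real.exp_pos u), Real.exp_neg]

/-- If the noise of `b` is large relative to the number of pulls, one of the exponential martingales
on the dyadic grid is large. -/
theorem exists_expo_of_sq_noiseSum {mean : Fin K → ℝ} {σ2 : ℝ≥0} (hσ : 0 < σ2) {b : Fin K} {u : ℝ}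
    (hu : 0 < u) {t T : ℕ} (ht : t ≤ T) {h : ℕ → Fin K × ℝ}
    (hlt : 4 * σ2 * u * pulls b t h < noiseSum mean b t h ^ 2) :
    ∃ k ≤ Nat.log 2 T, u ≤ expo mean σ2 b √(u / (σ2 * 2 ^ k)) t h ∨
      u ≤ expo mean σ2 b (-√(u / (σ2 * 2 ^ k))) t h := by
  have hN : pulls b t h ≠ 0 := fun h0 => by
    simp [h0, noiseSum_eq_zero h0] at hlt
  -- With `2 ^ k ≤ N < 2 ^ (k + 1)`, the tilt `l` makes the quadratic term at most `u`, while the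
  -- hypothesis gives `l |M| > 2 u`; the sign of `M` selects the tilt.
  refine ⟨Nat.log 2 (pulls b t h), Nat.log_mono_right ((pulls_le b t h).trans ht), ?_⟩
  set N := pulls b t h with hNd
  set M := noiseSum mean b t h with hM
  set k := Nat.log 2 N with hk
  set l := √(u / (σ2 * 2 ^ k)) with hl
  have hσ' : (0 : ℝ) < σ2 := hσ
  have hl0 : 0 < l := Real.sqrt_pos.2 (by positivity)
  have hl2 : l ^ 2 * (σ2 * 2 ^ k) = u := by
    rw [hl, Real.sq_sqrt (by positivity)]
    field_simp
  have h1 : (2 : ℝ) ^ k ≤ N := by exact_mod_cast Nat.pow_log_le_self 2 hN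
  have h2 : (N : ℝ) ≤ 2 * 2 ^ k := by
    have := (Nat.lt_pow_succ_log_self (b := 2) (by norm_num) N).le
    rw [pow_succ] at this
    have h3 : (N : ℝ) ≤ 2 ^ k * 2 := by exact_mod_cast this
    linarith
  have h3 : 2 * u < l * |M| := by
    refine lt_of_pow_lt_pow_left₀ 2 (by positivity) ?_
    rw [mul_pow l, sq_abs]
    calc (2 * u) ^ 2 = l ^ 2 * (4 * σ2 * u * 2 ^ k) := by rw [← hl2]; ring
      _ ≤ l ^ 2 * (4 * σ2 * u * N) := by gcongr
      _ < l ^ 2 * M ^ 2 := by gcongr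
  have h4 : l ^ 2 * σ2 / 2 * N ≤ u := by
    calc l ^ 2 * σ2 / 2 * N ≤ l ^ 2 * σ2 / 2 * (2 * 2 ^ k) := by gcongr
      _ = u := by rw [← hl2]; ring
  unfold expo
  rw [← hM, ← hNd, neg_sq]
  rcases abs_cases M with ⟨h5, -⟩ | ⟨h5, -⟩
  · left; rw [h5] at h3; linarith
  · right; rw [h5] at h3; linarith

/-- Time-uniform control of the noise of all arms. -/
theorem Policy.law_exists_sq_noiseSum (π : Policy K) (mean : Fin K → ℝ) {σ2 : ℝ≥0} (hσ : 0 < σ2)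
    {u : ℝ} (hu : 0 < u) (T : ℕ) :
    π.law mean σ2 {h | ∃ t ≤ T, ∃ b, 4 * σ2 * u * pulls b t h < noiseSum mean b t h ^ 2} ≤
      ENNReal.ofReal (2 * K * (Nat.log 2 T + 1) * Real.exp (-u)) := by
  let E : ℝ → Fin K → Set (ℕ → Fin K × ℝ) := fun l b => {h | ∃ t ≤ T, u ≤ expo mean σ2 b l t h}
  calc _ ≤ π.law mean σ2 (⋃ b ∈ (Finset.univ : Finset (Fin K)),
        ⋃ k ∈ Finset.range (Nat.log 2 T + 1),
          (E √(u / (σ2 * 2 ^ k)) b ∪ E (-√(u / (σ2 * 2 ^ k))) b)) := by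
        refine measure_mono ?_
        rintro h ⟨t, ht, b, hb⟩
        obtain ⟨k, hk, h1⟩ := exists_expo_of_sq_noiseSum hσ hu ht hb
        simp only [Set.mem_iUnion]
        exact ⟨b, Finset.mem_univ b, k, Finset.mem_range_succ_iff.2 hk,
          h1.imp (fun h2 => ⟨t, ht, h2⟩) fun h2 => ⟨t, ht, h2⟩⟩
    _ ≤ ∑ b : Fin K, ∑ k ∈ Finset.range (Nat.log 2 T + 1),
          (ENNReal.ofReal (Real.exp (-u)) + ENNReal.ofReal (Real.exp (-u))) := by
        refine (measure_biUnion_finset_le _ _).trans (Finset.sum_le_sum fun b _ => ?_)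
        refine (measure_biUnion_finset_le _ _).trans (Finset.sum_le_sum fun k _ => ?_)
        exact (measure_union_le _ _).trans (add_le_add (π.law_exists_le_expo _ _ _ _ _ _)
          (π.law_exists_le_expo _ _ _ _ _ _))
    _ = _ := by
        rw [← ENNReal.ofReal_add (by positivity) (by positivity)]
        simp only [Finset.sum_const, nsmul_eq_mul, Finset.card_univ, Fintype.card_fin,
          Finset.card_range]
        rw [← ENNReal.ofReal_natCast, ← ENNReal.ofReal_natCast,
          ← ENNReal.ofReal_mul (by positivity), ← ENNReal.ofReal_mul (by positivity)]
        congr 1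
        push_cast
        ring

/-! ### Accuracy of the user's least squares estimate. -/

theorem sum_arm {t : ℕ} (h : ℕ → Fin K × ℝ) (f : Fin K → ℝ) :
    ∑ s ∈ Finset.range t, f (h s).1 = ∑ b, pulls b t h * f b := by
  simp only [pulls, Nat.cast_sum, Finset.sum_mul]
  rw [Finset.sum_comm]
  simp

theorem sum_noise {t : ℕ} (mean : Fin K → ℝ) (h : ℕ → Fin K × ℝ) (f : Fin K → ℝ) :
    ∑ s ∈ Finset.range t, ((h s).2 - mean (h s).1) * f (h s).1 =
      ∑ b, noiseSum mean b t h * f b := by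
  simp only [noiseSum, Finset.sum_mul]
  rw [Finset.sum_comm]
  simp

/-- Deterministic error bound for (ridge) least squares. -/
theorem IsLeastSquares.pulls_mul_sq_le {lam : ℝ} (hlam : 0 ≤ lam) {x : Fin K → Fin d → ℝ}
    {h : ℕ → Fin K × ℝ} {t : ℕ} {θhat : Fin d → ℝ} (hls : IsLeastSquares lam x h t θhat)
    (θ : Fin d → ℝ) {U : ℝ} (hU0 : 0 ≤ U)
    (hU : ∀ b, noiseSum (fun a => x a ⬝ᵥ θ) b t h ^ 2 ≤ U * pulls b t h) (a : Fin K) :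
    pulls a t h * (x a ⬝ᵥ θhat - x a ⬝ᵥ θ) ^ 2 ≤ 4 * K * U + 2 * (lam * (θ ⬝ᵥ θ)) := by
  have h1 := hls θ
  set y : Fin K → ℝ := fun b => x b ⬝ᵥ θhat - x b ⬝ᵥ θ with hy
  set M : Fin K → ℝ := fun b => noiseSum (fun a => x a ⬝ᵥ θ) b t h with hM
  have h2 : ∑ s ∈ Finset.range t, ((h s).2 - x (h s).1 ⬝ᵥ θhat) ^ 2 =
      ∑ s ∈ Finset.range t, ((h s).2 - x (h s).1 ⬝ᵥ θ) ^ 2 - 2 * ∑ b, M b * y b +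
        ∑ b, pulls b t h * y b ^ 2 := by
    rw [← sum_noise, ← sum_arm h fun b => y b ^ 2, Finset.mul_sum, ← Finset.sum_sub_distrib,
      ← Finset.sum_add_distrib]
    refine Finset.sum_congr rfl fun s _ => ?_
    simp only [hy]
    ring
  have h3 : 0 ≤ lam * (θhat ⬝ᵥ θhat) := mul_nonneg hlam
    (by simpa using dotProduct_star_self_nonneg θhat)
  -- Young's inequality spends half of the prediction error on the cross term. Working with
  -- prediction errors avoids any invertibility assumption, so `lam = 0` is covered.
  have h4 : ∀ b, 2 * (M b * y b) ≤ 2 * U + pulls b t h * y b ^ 2 / 2 := fun b => by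
    by_cases h0 : pulls b t h = 0
    · have : M b = 0 := noiseSum_eq_zero h0
      rw [this, h0]; simp [hU0]
    · have hp : (0 : ℝ) < pulls b t h := by exact_mod_cast Nat.pos_of_ne_zero h0
      have h5 : M b ^ 2 / pulls b t h ≤ U := (div_le_iff₀ hp).2 (hU b)
      have h6 : 0 ≤ (2 * M b - pulls b t h * y b) ^ 2 / (2 * pulls b t h) := by positivity
      have h7 : (2 * M b - pulls b t h * y b) ^ 2 / (2 * pulls b t h) =
        2 * (M b ^ 2 / pulls b t h) - 2 * (M b * y b) + pulls b t h * y b ^ 2 / 2 := by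
        field_simp; ring
      linarith
  have h5 : 2 * ∑ b, M b * y b ≤ 2 * K * U + (∑ b, pulls b t h * y b ^ 2) / 2 := by
    rw [Finset.mul_sum]
    refine (Finset.sum_le_sum fun b _ => h4 b).trans_eq ?_
    rw [Finset.sum_add_distrib, Finset.sum_div]
    simp; ring
  have h6 : pulls a t h * y a ^ 2 ≤ ∑ b, pulls b t h * y b ^ 2 :=
    Finset.single_le_sum (f := fun b => (pulls b t h : ℝ) * y b ^ 2)
      (fun b _ => by positivity) (Finset.mem_univ a)
  change pulls a t h * y a ^ 2 ≤ _
  linarith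

/-- The rounds in which arm `b` is pulled with fewer than `n` earlier pulls. -/
theorem sum_ite_pulls_lt (b : Fin K) (n T : ℕ) (h : ℕ → Fin K × ℝ) :
    ∑ t ∈ Finset.range T, (if (h t).1 = b ∧ pulls b t h < n then 1 else 0) =
      min (pulls b T h) n := by
  induction T with
  | zero => simp [pulls]
  | succ T ih =>
    rw [Finset.sum_range_succ, ih, pulls_succ]
    by_cases h1 : (h T).1 = b
    · simp only [h1, true_and, if_true]; split_ifs <;> omega
    · simp [h1]

/-! ### Consistency forces logarithmic information. -/

theorem gap_nonneg (mean : Fin K → ℝ) (a : Fin K) : 0 ≤ gap mean a :=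
  sub_nonneg.2 (le_ciSup (Set.finite_range mean).bddAbove a)

theorem integrable_gap (π : Policy K) (mean mean' : Fin K → ℝ) (σ2 : ℝ≥0) (t : ℕ) :
    Integrable (fun h => gap mean (h t).1) (π.law mean' σ2) := by
  refine Integrable.of_bound (C := ∑ a, ‖gap mean a‖)
    ((measurable_of_finite (gap mean)).comp (measurable_arm t)).aestronglyMeasurable
    (ae_of_all _ fun h => ?_)
  exact Finset.single_le_sum (f := fun a => ‖gap mean a‖) (fun _ _ => norm_nonneg _)
    (Finset.mem_univ _)

/-- Pulling arms with positive gaps often is unlikely when the regret is small. -/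
theorem Policy.law_real_le_regret (π : Policy K) (mean : Fin K → ℝ) (σ2 : ℝ≥0)
    (B : Finset (Fin K)) {g : ℝ} (hg : 0 < g) (hB : ∀ b ∈ B, g ≤ gap mean b) (T : ℕ) {x : ℝ}
    (hx : 0 < x) :
    (π.law mean σ2).real {h | x ≤ ∑ b ∈ B, (pulls b T h : ℝ)} ≤
      π.regret mean σ2 T / (g * x) := by
  have h1 : π.regret mean σ2 T =
      ∫ h, ∑ t ∈ Finset.range T, gap mean (h t).1 ∂π.law mean σ2 :=
    (integral_finsetSum _ fun t _ => integrable_gap π mean mean σ2 t).symm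
  have h2 := mul_meas_ge_le_integral_of_nonneg (μ := π.law mean σ2)
    (f := fun h => ∑ t ∈ Finset.range T, gap mean (h t).1)
    (ae_of_all _ fun h => Finset.sum_nonneg fun t _ => gap_nonneg _ _)
    (integrable_finsetSum _ fun t _ => integrable_gap π mean mean σ2 t) (g * x)
  rw [← h1] at h2
  rw [le_div_iff₀ (by positivity), mul_comm]
  refine le_trans ?_ h2
  refine mul_le_mul_of_nonneg_left (measureReal_mono fun h hh => ?_) (by positivity)
  have hh' : x ≤ ∑ b ∈ B, (pulls b T h : ℝ) := hh
  change g * x ≤ _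
  rw [sum_arm]
  calc g * x ≤ ∑ b ∈ B, pulls b T h * g := by
        rw [← Finset.sum_mul, mul_comm]; gcongr
    _ ≤ ∑ b ∈ B, pulls b T h * gap mean b :=
        Finset.sum_le_sum fun b hb => by gcongr; exact hB b hb
    _ ≤ _ := Finset.sum_le_univ_sum_of_nonneg fun b => mul_nonneg (by positivity) (gap_nonneg _ _)

/-- Suboptimal arms are pulled in less than a fixed fraction of the rounds. -/
theorem Policy.tendsto_law_suboptimal (π : Policy K) {mean : Fin K → ℝ} {σ2 : ℝ≥0}
    (hreg : (fun T => π.regret mean σ2 T) =o[atTop] fun T : ℕ => (T : ℝ) ^ (1 : ℝ))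
    (B : Finset (Fin K)) {g : ℝ} (hg : 0 < g) (hB : ∀ b ∈ B, g ≤ gap mean b) :
    Tendsto (fun T : ℕ => (π.law mean σ2).real
      {h | (T : ℝ) / 2 ≤ ∑ b ∈ B, (pulls b T h : ℝ)}) atTop (𝓝 0) := by
  have h1 := (hreg.tendsto_div_nhds_zero).const_mul (2 / g)
  rw [mul_zero] at h1
  refine squeeze_zero' (.of_forall fun _ => measureReal_nonneg) ?_ h1
  filter_upwards [eventually_gt_atTop 0] with T hT
  have hT' : (0 : ℝ) < T := by exact_mod_cast hT
  refine (π.law_real_le_regret mean σ2 B hg hB T (by positivity)).trans_eq ?_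
  rw [Real.rpow_one]
  field_simp

/-- The information for telling `mean` from a bandit in which the optimal arms become suboptimal
exceeds half of `log T` with probability tending to one. -/
theorem Policy.tendsto_law_infoSum (π : Policy K) {mean mean' : Fin K → ℝ} {σ2 : ℝ≥0}
    (hσ : σ2 ≠ 0)
    (hreg : (fun T => π.regret mean σ2 T) =o[atTop] fun T : ℕ => (T : ℝ) ^ (1 : ℝ))
    (hreg' : (fun T => π.regret mean' σ2 T) =o[atTop] fun T : ℕ => (T : ℝ) ^ (1 / 2 : ℝ))
    (B : Finset (Fin K)) {g g' : ℝ} (hg : 0 < g) (hB : ∀ b ∈ B, g ≤ gap mean b)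
    (hg' : 0 < g') (hB' : ∀ b ∉ B, g' ≤ gap mean' b) :
    Tendsto (fun T : ℕ => (π.law mean σ2).real
      {h | infoSum mean mean' σ2 T h < Real.log T / 2}) atTop (𝓝 0) := by
  have h1 := (hreg'.tendsto_div_nhds_zero).const_mul (2 / g')
  rw [mul_zero] at h1
  have h2 := (h1.sqrt).add (π.tendsto_law_suboptimal hreg B hg hB)
  rw [Real.sqrt_zero, add_zero] at h2
  refine squeeze_zero' (.of_forall fun _ => measureReal_nonneg) ?_ h2
  filter_upwards [eventually_gt_atTop 0] with T hT
  have hT' : (0 : ℝ) < T := by exact_mod_cast hT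
  -- On `A` the likelihood cost is at most `T ^ (1/2)`, yet arms that are bad under `mean'` fill
  -- half of the rounds, so `regret'` controls its `mean'`-probability.
  set A : Set (ℕ → Fin K × ℝ) := {h | infoSum mean mean' σ2 T h < Real.log T / 2 ∧
    (T : ℝ) / 2 ≤ ∑ b ∈ Bᶜ, (pulls b T h : ℝ)} with hA
  have hp : ∀ b : Fin K, Measurable fun h : ℕ → Fin K × ℝ => (pulls b T h : ℝ) := fun b =>
    measurable_from_top.comp (measurable_pulls b T)
  have hAm : MeasurableSet A := by
    exact (measurableSet_lt (measurable_infoSum mean mean' σ2 T) measurable_const).inter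
      (measurableSet_le measurable_const (Finset.measurable_sum _ fun b _ => hp b))
  have hAd : DependsOn (A.indicator (1 : (ℕ → Fin K × ℝ) → ℝ≥0∞)) (Set.Iio T) := by
    intro h h' hh
    have : h ∈ A ↔ h' ∈ A := by
      simp only [hA, Set.mem_ofPred_eq, dependsOn_infoSum mean mean' σ2 T hh,
        dependsOn_pulls _ T hh]
    by_cases hm : h ∈ A
    · rw [Set.indicator_of_mem hm, Set.indicator_of_mem (this.1 hm)]
      rfl
    · rw [Set.indicator_of_notMem hm, Set.indicator_of_notMem (this.not.1 hm)]
  have h3 : π.law mean σ2 A ^ 2 ≤ ENNReal.ofReal ((T : ℝ) ^ (1 / 2 : ℝ)) * π.law mean' σ2 A := by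
    have h4 := π.sq_lintegral_law_le mean mean' hσ T (measurable_one.indicator hAm) hAd
    rw [lintegral_indicator_one hAm] at h4
    refine h4.trans ?_
    rw [← lintegral_indicator_one hAm, ← lintegral_const_mul _ (measurable_one.indicator hAm)]
    refine lintegral_mono fun h => ?_
    by_cases hm : h ∈ A
    · simp only [Set.indicator_of_mem hm, Pi.one_apply, one_pow, mul_one]
      refine ENNReal.ofReal_le_ofReal ?_
      rw [Real.rpow_def_of_pos hT']
      exact Real.exp_le_exp.2 (by linarith [hm.1])
    · simp [Set.indicator_of_notMem hm]
  have h5 : (π.law mean σ2).real A ^ 2 ≤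
      (T : ℝ) ^ (1 / 2 : ℝ) * (π.law mean' σ2).real A := by
    have := ENNReal.toReal_mono (ENNReal.mul_ne_top ENNReal.ofReal_ne_top (measure_ne_top _ _)) h3
    rwa [ENNReal.toReal_pow, ENNReal.toReal_mul, ENNReal.toReal_ofReal (by positivity)] at this
  have h6 : (π.law mean' σ2).real A ≤ π.regret mean' σ2 T / (g' * (T / 2)) :=
    (measureReal_mono fun h hh => hh.2).trans
      (π.law_real_le_regret mean' σ2 Bᶜ hg' (fun b hb => hB' b (by simpa using hb)) T
        (by positivity))
  have h7 : (π.law mean σ2).real A ≤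
      √(2 / g' * (π.regret mean' σ2 T / (T : ℝ) ^ (1 / 2 : ℝ))) := by
    refine Real.le_sqrt_of_sq_le (h5.trans ?_)
    calc _ ≤ (T : ℝ) ^ (1 / 2 : ℝ) * (π.regret mean' σ2 T / (g' * (T / 2))) := by gcongr
      _ = _ := by
        have h8 : (T : ℝ) = (T : ℝ) ^ (1 / 2 : ℝ) * (T : ℝ) ^ (1 / 2 : ℝ) := by
          rw [← Real.rpow_add hT']; norm_num
        have h9 : (T : ℝ) ^ (1 / 2 : ℝ) ≠ 0 := by positivity
        set r := (T : ℝ) ^ (1 / 2 : ℝ)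
        rw [h8]
        field_simp
  refine le_trans ?_ (add_le_add_left h7 _)
  -- Outside `A`, little information means that the arms of `B` take at least half of the rounds,
  -- which is unlikely under `mean`.
  refine (measureReal_mono ?_).trans (measureReal_union_le _ _)
  intro h hh
  by_cases h8 : (T : ℝ) / 2 ≤ ∑ b ∈ Bᶜ, (pulls b T h : ℝ)
  · exact Or.inl ⟨hh, h8⟩
  · right
    have h9 : ∑ b ∈ B, (pulls b T h : ℝ) + ∑ b ∈ Bᶜ, (pulls b T h : ℝ) = T := by
      rw [Finset.sum_add_sum_compl]
      exact_mod_cast sum_pulls T h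
    change (T : ℝ) / 2 ≤ ∑ b ∈ B, (pulls b T h : ℝ)
    linarith

/-! ### Design matrices, confusing directions and the optimal value. -/

theorem dotProduct_designMatrix (v : Fin K → Fin d → ℝ) (α : Fin K → ℝ) (x y : Fin d → ℝ) :
    x ⬝ᵥ (designMatrix v α *ᵥ y) = ∑ a, α a * ((v a ⬝ᵥ x) * (v a ⬝ᵥ y)) := by
  rw [designMatrix, Matrix.sum_mulVec, dotProduct_sum]
  refine Finset.sum_congr rfl fun a _ => ?_
  rw [Matrix.smul_mulVec, Matrix.vecMulVec_mulVec, dotProduct_smul]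
  simp only [op_smul_eq_smul, dotProduct_smul, smul_eq_mul]
  rw [dotProduct_comm x]
  ring

theorem isHermitian_designMatrix (v : Fin K → Fin d → ℝ) (α : Fin K → ℝ) :
    (designMatrix v α).IsHermitian := by
  ext i j
  simp only [designMatrix, Matrix.conjTranspose_apply, Matrix.sum_apply, Matrix.smul_apply,
    Matrix.vecMulVec_apply, star_trivial]
  exact Finset.sum_congr rfl fun a _ => by simp only [smul_eq_mul]; ring

/-- Orthogonality extends from the features to their span, which contains `x` itself. -/
theorem eq_zero_of_dotProduct_eq_zero {v : Fin K → Fin d → ℝ}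
    (hv : Submodule.span ℝ (Set.range v) = ⊤) {x : Fin d → ℝ} (hx : ∀ a, v a ⬝ᵥ x = 0) :
    x = 0 := by
  have h1 : ∀ y ∈ Submodule.span ℝ (Set.range v), y ⬝ᵥ x = 0 := fun y hy => by
    induction hy using Submodule.span_induction with
    | mem y hy => obtain ⟨a, rfl⟩ := hy; exact hx a
    | zero => simp
    | add y z _ _ hy hz => rw [add_dotProduct, hy, hz, add_zero]
    | smul c y _ hy => rw [smul_dotProduct, hy, smul_zero]
  exact dotProduct_self_eq_zero.1 (h1 x (hv ▸ Submodule.mem_top))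

theorem posDef_designMatrix {v : Fin K → Fin d → ℝ}
    (hv : Submodule.span ℝ (Set.range v) = ⊤) {α : Fin K → ℝ} (hα : ∀ a, 0 < α a) :
    (designMatrix v α).PosDef := by
  refine Matrix.PosDef.of_dotProduct_mulVec_pos (isHermitian_designMatrix v α) fun x hx => ?_
  rw [star_trivial, dotProduct_designMatrix]
  by_contra! h
  refine hx (eq_zero_of_dotProduct_eq_zero hv fun a => ?_)
  have h0 : ∀ a ∈ Finset.univ, 0 ≤ α a * ((v a ⬝ᵥ x) * (v a ⬝ᵥ x)) := fun a _ =>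
    mul_nonneg (hα a).le (mul_self_nonneg _)
  have h1 := (Finset.sum_eq_zero_iff_of_nonneg h0).1 (le_antisymm h (Finset.sum_nonneg h0)) a
    (Finset.mem_univ a)
  simpa [(hα a).ne'] using h1

/-- If the width of `y` is large, there is a direction along `y` of small energy. -/
theorem exists_direction_of_lt_width {v : Fin K → Fin d → ℝ} {α : Fin K → ℝ}
    (hα : (designMatrix v α).PosDef) {y : Fin d → ℝ} {r : ℝ} (hr : 0 < r) (q : ℝ)
    (h : r < y ⬝ᵥ ((designMatrix v α)⁻¹ *ᵥ y)) :
    ∃ u, y ⬝ᵥ u = q ∧ ∑ a, α a * (v a ⬝ᵥ u) ^ 2 ≤ q ^ 2 / r := by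
  set H := designMatrix v α with hH
  set w := H⁻¹ *ᵥ y with hw
  have hunit : IsUnit H.det := (Matrix.isUnit_iff_isUnit_det _).1 hα.isUnit
  have hτ : 0 < y ⬝ᵥ w := hr.trans h
  have hHw : H *ᵥ w = y := by
    rw [hw, Matrix.mulVec_mulVec, Matrix.mul_nonsing_inv _ hunit, Matrix.one_mulVec]
  have h1 : ∑ a, α a * (v a ⬝ᵥ w) ^ 2 = y ⬝ᵥ w := by
    have := dotProduct_designMatrix v α w w
    rw [← hH, hHw, dotProduct_comm] at this
    rw [this]
    exact Finset.sum_congr rfl fun a _ => by ring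
  -- This is the energy minimizer on the hyperplane `y ⬝ᵥ u = q`, with energy `q ^ 2 / (y ⬝ᵥ w)`.
  refine ⟨(q / (y ⬝ᵥ w)) • w, ?_, ?_⟩
  · rw [dotProduct_smul, smul_eq_mul]; field_simp
  · have h2 : ∑ a, α a * (v a ⬝ᵥ ((q / (y ⬝ᵥ w)) • w)) ^ 2 = q ^ 2 / (y ⬝ᵥ w) := by
      simp only [dotProduct_smul, smul_eq_mul, mul_pow]
      calc _ = (q / (y ⬝ᵥ w)) ^ 2 * ∑ a, α a * (v a ⬝ᵥ w) ^ 2 := by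
            rw [Finset.mul_sum]; exact Finset.sum_congr rfl fun a _ => by ring
        _ = _ := by rw [h1]; field_simp
    rw [h2]
    gcongr

/-- Compactness: directions of bounded energy for all weights `M` on `O` have a common member that
is orthogonal to the features of `O`. -/
theorem exists_direction_of_forall {v : Fin K → Fin d → ℝ}
    (hv : Submodule.span ℝ (Set.range v) = ⊤) (O : Finset (Fin K)) {β : Fin K → ℝ}
    (hβ : ∀ b ∉ O, 0 < β b) (y : Fin d → ℝ) (q r : ℝ)
    (h : ∀ M : ℕ, ∃ u, y ⬝ᵥ u = q ∧
      ∑ b, (if b ∈ O then ((M : ℝ) + 1) else β b) * (v b ⬝ᵥ u) ^ 2 ≤ r) :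
    ∃ u, y ⬝ᵥ u = q ∧ (∀ b ∈ O, v b ⬝ᵥ u = 0) ∧ ∑ b ∈ Oᶜ, β b * (v b ⬝ᵥ u) ^ 2 ≤ r := by
  -- The shift `M + 1` keeps all weights positive at `M = 0`; as the features span, `C 0` is then
  -- bounded.
  let γ : ℕ → Fin K → ℝ := fun M b => if b ∈ O then ((M : ℝ) + 1) else β b
  have hγ : ∀ M b, 0 < γ M b := fun M b => by
    by_cases hb : b ∈ O
    · simp only [γ, hb, if_true]; positivity
    · simp only [γ, hb, if_false]; exact hβ b hb
  let C : ℕ → Set (Fin d → ℝ) := fun M => {u | y ⬝ᵥ u = q ∧ ∑ b, γ M b * (v b ⬝ᵥ u) ^ 2 ≤ r}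
  have hcont : ∀ z : Fin d → ℝ, Continuous fun u : Fin d → ℝ => z ⬝ᵥ u := fun z => by
    unfold dotProduct; fun_prop
  have hclosed : ∀ M, IsClosed (C M) := fun M =>
    (isClosed_eq (hcont y) continuous_const).inter
      (isClosed_le (continuous_finsetSum _ fun b _ => ((hcont (v b)).pow 2).const_mul _)
        continuous_const)
  have hcompact : IsCompact (C 0) := by
    let f : (Fin d → ℝ) →ₗ[ℝ] (Fin K → ℝ) := Matrix.mulVecLin (Matrix.of v)
    have hf : ∀ u b, f u b = v b ⬝ᵥ u := fun u b => rfl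
    have hinj : LinearMap.ker f = ⊥ := LinearMap.ker_eq_bot'.2 fun u hu =>
      eq_zero_of_dotProduct_eq_zero hv fun b => by rw [← hf, hu]; rfl
    have hemb := LinearMap.isClosedEmbedding_of_injective hinj
    let R : Fin K → ℝ := fun b => √(r / γ 0 b)
    refine (hemb.isCompact_preimage (isCompact_Icc (a := fun b => -R b) (b := R))).of_isClosed_subset
      (hclosed 0) ?_
    rintro u ⟨-, hu⟩
    have h1 : ∀ b, |v b ⬝ᵥ u| ≤ R b := fun b => by
      refine Real.abs_le_sqrt ?_
      rw [le_div_iff₀ (hγ 0 b), mul_comm]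
      exact (Finset.single_le_sum (f := fun b => γ 0 b * (v b ⬝ᵥ u) ^ 2)
        (fun b _ => mul_nonneg (hγ 0 b).le (sq_nonneg _)) (Finset.mem_univ b)).trans hu
    exact ⟨fun b => (abs_le.1 (h1 b)).1, fun b => (abs_le.1 (h1 b)).2⟩
  have hanti : ∀ M, C (M + 1) ⊆ C M := by
    rintro M u ⟨h1, h2⟩
    refine ⟨h1, le_trans (Finset.sum_le_sum fun b _ => ?_) h2⟩
    gcongr
    by_cases hb : b ∈ O
    · simp [γ, hb]
    · simp [γ, hb]
  obtain ⟨u, hu⟩ := IsCompact.nonempty_iInter_of_sequence_nonempty_isCompact_isClosed C hanti h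
    hcompact hclosed
  rw [Set.mem_iInter] at hu
  have hsplit : ∀ M : ℕ, ((M : ℝ) + 1) * ∑ b ∈ O, (v b ⬝ᵥ u) ^ 2 +
      ∑ b ∈ Oᶜ, β b * (v b ⬝ᵥ u) ^ 2 ≤ r := fun M => by
    refine le_trans (le_of_eq ?_) (hu M).2
    rw [← Finset.sum_add_sum_compl O, Finset.mul_sum]
    congr 1
    · exact Finset.sum_congr rfl fun b hb => by simp [γ, hb]
    · exact Finset.sum_congr rfl fun b hb => by simp [γ, Finset.mem_compl.1 hb]
  have hS : 0 ≤ ∑ b ∈ Oᶜ, β b * (v b ⬝ᵥ u) ^ 2 := Finset.sum_nonneg fun b hb =>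
    mul_nonneg (hβ b (Finset.mem_compl.1 hb)).le (sq_nonneg _)
  have hO : 0 ≤ ∑ b ∈ O, (v b ⬝ᵥ u) ^ 2 := Finset.sum_nonneg fun b _ => sq_nonneg _
  have hO0 : ∑ b ∈ O, (v b ⬝ᵥ u) ^ 2 = 0 := by
    by_contra hne
    have hpos := lt_of_le_of_ne hO (Ne.symm hne)
    obtain ⟨M, hM⟩ := exists_nat_gt (r / ∑ b ∈ O, (v b ⬝ᵥ u) ^ 2)
    rw [div_lt_iff₀ hpos] at hM
    have := hsplit M
    nlinarith
  refine ⟨u, (hu 0).1, fun b hb => ?_, ?_⟩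
  · exact pow_eq_zero_iff (two_ne_zero) |>.1
      ((Finset.sum_eq_zero_iff_of_nonneg fun b _ => sq_nonneg _).1 hO0 b hb)
  · have := hsplit 0
    rwa [hO0, mul_zero, zero_add] at this

theorem IsFeasible.cost_nonneg {v : Fin K → Fin d → ℝ} {mean : Fin K → ℝ} {α : Fin K → ℝ}
    (h : IsFeasible v mean α) : 0 ≤ ∑ a, α a * (gap mean a / 3) :=
  Finset.sum_nonneg fun a _ => mul_nonneg (h.nonneg a) (by linarith [gap_nonneg mean a])

theorem IsFeasible.optValue_le {v : Fin K → Fin d → ℝ} {mean : Fin K → ℝ} {α : Fin K → ℝ}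
    (h : IsFeasible v mean α) : optValue v mean ≤ ∑ a, α a * (gap mean a / 3) :=
  csInf_le ⟨0, by rintro y ⟨α', h', rfl⟩; exact h'.cost_nonneg⟩ ⟨α, h, rfl⟩

/-- If no confusing direction has energy below `c` with respect to `β`, a multiple of `β`,
completed by large weights on the optimal arms, is feasible. -/
theorem optValue_le_of_energy {v : Fin K → Fin d → ℝ}
    (hv : Submodule.span ℝ (Set.range v) = ⊤) {mean : Fin K → ℝ} {β : Fin K → ℝ}
    (hβ : ∀ b, 0 < β b) {c : ℝ} (hc : 0 < c)
    (hw : ∀ a, 0 < gap mean a → ∀ u, (∀ b, gap mean b = 0 → v b ⬝ᵥ u = 0) →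
      v a ⬝ᵥ u = 2 * gap mean a →
        c ≤ ∑ b ∈ Finset.univ.filter fun b => gap mean b ≠ 0, β b * (v b ⬝ᵥ u) ^ 2) :
    optValue v mean ≤ 16 / c * ∑ b, β b * (gap mean b / 3) := by
  set O : Finset (Fin K) := Finset.univ.filter fun b => gap mean b = 0 with hO
  have hOc : Oᶜ = Finset.univ.filter fun b => gap mean b ≠ 0 := by
    ext b; simp [hO]
  let γ : ℕ → Fin K → ℝ := fun M b => if b ∈ O then ((M : ℝ) + 1) else β b
  have hγ : ∀ M b, 0 < γ M b := fun M b => by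
    by_cases hb : b ∈ O
    · simp only [γ, hb, if_true]; positivity
    · simp only [γ, hb, if_false]; exact hβ b
  -- If no weight on the optimal arms worked, the limiting direction would be orthogonal to them
  -- with energy at most `c / 2`, against `hw`.
  have h1 : ∀ a, ∃ M : ℕ, 0 < gap mean a →
      ∀ u, v a ⬝ᵥ u = 2 * gap mean a → c / 2 < ∑ b, γ M b * (v b ⬝ᵥ u) ^ 2 := by
    intro a
    by_contra! hcon
    have hgap := (hcon 0).1
    obtain ⟨u, hu1, hu2, hu3⟩ := exists_direction_of_forall hv O (fun b _ => hβ b) (v a)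
      (2 * gap mean a) (c / 2) fun M => (hcon M).2
    have := hw a hgap u (fun b hb => hu2 b (by simp [hO, hb])) hu1
    rw [← hOc] at this
    linarith
  choose Mf hMf using h1
  set M := ∑ a, Mf a with hM
  -- The factor `16 / c` lifts energy `c / 2` to `8`, which equals `(2 Δ)² / (Δ² / 2)`, the most
  -- energy that a violated width constraint allows.
  have hfeas : IsFeasible v mean fun a => 16 / c * γ M a := by
    have hpd : (designMatrix v fun a => 16 / c * γ M a).PosDef :=
      posDef_designMatrix hv fun a => mul_pos (by positivity) (hγ M a)
    refine ⟨fun a => (mul_pos (by positivity) (hγ M a)).le, hpd, fun a ha => ?_⟩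
    by_contra! hlt
    obtain ⟨u, hu1, hu2⟩ := exists_direction_of_lt_width hpd (by positivity) (2 * gap mean a) hlt
    have h2 := hMf a ha u hu1
    have h3 : ∑ b, γ (Mf a) b * (v b ⬝ᵥ u) ^ 2 ≤ ∑ b, γ M b * (v b ⬝ᵥ u) ^ 2 := by
      refine Finset.sum_le_sum fun b _ => ?_
      gcongr
      by_cases hb : b ∈ O
      · simp only [γ, hb, if_true]
        gcongr
        exact Finset.single_le_sum (f := Mf) (fun _ _ => Nat.zero_le _) (Finset.mem_univ a)
      · simp [γ, hb]
    have h4 : ∑ b, 16 / c * γ M b * (v b ⬝ᵥ u) ^ 2 =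
        16 / c * ∑ b, γ M b * (v b ⬝ᵥ u) ^ 2 := by
      rw [Finset.mul_sum]; exact Finset.sum_congr rfl fun b _ => by ring
    have h5 : (2 * gap mean a) ^ 2 / (gap mean a ^ 2 / 2) = 8 := by
      field_simp; norm_num
    rw [h4, h5] at hu2
    have h6 : 16 / c * (c / 2) < 16 / c * ∑ b, γ M b * (v b ⬝ᵥ u) ^ 2 := by
      gcongr; exact h2.trans_le h3
    have h7 : 16 / c * (c / 2) = 8 := by field_simp; norm_num
    linarith
  refine hfeas.optValue_le.trans_eq ?_
  rw [Finset.mul_sum]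
  refine Finset.sum_congr rfl fun b _ => ?_
  by_cases hb : b ∈ O
  · have : gap mean b = 0 := by simpa [hO] using hb
    simp [this]
  · simp only [γ, hb, if_false]; ring

/-- Weights which eventually put energy `c` on each confusing direction eventually cost a constant
fraction of the optimal value. -/
theorem eventually_optValue_le {v : Fin K → Fin d → ℝ}
    (hv : Submodule.span ℝ (Set.range v) = ⊤) {mean : Fin K → ℝ} {α : ℕ → Fin K → ℝ}
    (hα : ∀ T b, 0 ≤ α T b) {c : ℝ} (hc : 0 < c)
    (hw : ∀ a, 0 < gap mean a → ∀ u, (∀ b, gap mean b = 0 → v b ⬝ᵥ u = 0) →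
      v a ⬝ᵥ u = 2 * gap mean a → ∀ᶠ T in atTop, c ≤ ∑ b, α T b * (v b ⬝ᵥ u) ^ 2) :
    ∀ᶠ T in atTop, c / 64 * optValue v mean ≤ ∑ b, α T b * (gap mean b / 3) := by
  have hcost : ∀ T, 0 ≤ ∑ b, α T b * (gap mean b / 3) := fun T => Finset.sum_nonneg fun b _ =>
    mul_nonneg (hα T b) (by linarith [gap_nonneg mean b])
  rcases le_or_gt (optValue v mean) 0 with hV | hV
  · exact .of_forall fun T => (mul_nonpos_of_nonneg_of_nonpos (by positivity) hV).trans (hcost T)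
  by_contra hcon
  rw [not_eventually] at hcon
  set B := c / 64 * optValue v mean with hB
  have hB0 : 0 < B := by positivity
  -- Cost does not bound the weights of optimal arms. Dropping them gives compactness and loses no
  -- energy, as confusing directions are orthogonal to these arms.
  let α' : ℕ → Fin K → ℝ := fun T b => if gap mean b = 0 then 0 else α T b
  let Q : Set (Fin K → ℝ) := {x | (∀ b, 0 ≤ x b) ∧ (∀ b, gap mean b = 0 → x b = 0) ∧
    ∑ b, x b * (gap mean b / 3) ≤ B}
  have hQclosed : IsClosed Q := by
    have h1 : Q = (⋂ b, {x | 0 ≤ x b}) ∩ ((⋂ b, {x | gap mean b = 0 → x b = 0}) ∩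
        {x | ∑ b, x b * (gap mean b / 3) ≤ B}) := by
      ext x; simp [Q]
    rw [h1]
    refine (isClosed_iInter fun b => isClosed_le continuous_const (continuous_apply b)).inter
      (IsClosed.inter (isClosed_iInter fun b => ?_) (isClosed_le (by fun_prop) continuous_const))
    by_cases hb : gap mean b = 0
    · simpa [hb] using isClosed_eq (continuous_apply b) continuous_const
    · simp [hb]
  have hQ : IsCompact Q := by
    refine (isCompact_Icc (a := (0 : Fin K → ℝ)) (b := fun b => 3 * B / gap mean b)).of_isClosed_subset
      hQclosed ?_
    rintro x ⟨hx0, hxO, hxB⟩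
    refine ⟨hx0, fun b => ?_⟩
    by_cases hb : gap mean b = 0
    · simp [hxO b hb, hb]
    · have hb' : 0 < gap mean b := lt_of_le_of_ne (gap_nonneg _ _) (Ne.symm hb)
      have := (Finset.single_le_sum (f := fun b => x b * (gap mean b / 3))
        (fun b _ => mul_nonneg (hx0 b) (by linarith [gap_nonneg mean b]))
        (Finset.mem_univ b)).trans hxB
      rw [le_div_iff₀ hb']
      linarith
  have hfreq : ∃ᶠ T in atTop, α' T ∈ Q := by
    refine hcon.mono fun T hT => ⟨fun b => ?_, fun b hb => by simp [α', hb], ?_⟩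
    · simp only [α']; split_ifs; exacts [le_rfl, hα T b]
    · refine le_trans (le_of_eq (Finset.sum_congr rfl fun b _ => ?_)) (not_le.1 hT).le
      by_cases hb : gap mean b = 0 <;> simp [α', hb]
  obtain ⟨x, hxQ, hx⟩ := hQ.exists_mapClusterPt_of_frequently hfreq
  set G := ∑ b, gap mean b / 3 with hG
  have hG0 : 0 ≤ G := Finset.sum_nonneg fun b _ => by linarith [gap_nonneg mean b]
  -- Adding `ε` makes all weights positive and dominates infinitely many `α' T`, while the cost
  -- grows by at most `B`.
  set ε := B / (G + 1) with hε
  have hε0 : 0 < ε := by positivity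
  have hnhds : {z : Fin K → ℝ | ∀ b, z b < x b + ε} ∈ 𝓝 x := by
    refine IsOpen.mem_nhds ?_ fun b => by linarith
    rw [show {z : Fin K → ℝ | ∀ b, z b < x b + ε} = ⋂ b, {z | z b < x b + ε} by ext; simp]
    exact isOpen_iInter_of_finite fun b =>
      isOpen_lt (continuous_apply b) continuous_const
  have hfreq2 := (mapClusterPt_iff_frequently.1 hx) _ hnhds
  have h1 := optValue_le_of_energy hv (mean := mean) (β := fun b => x b + ε)
    (fun b => add_pos_of_nonneg_of_pos (hxQ.1 b) hε0) hc fun a ha u hu1 hu2 => by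
      obtain ⟨T, hT1, hT2⟩ := (hfreq2.and_eventually (hw a ha u hu1 hu2)).exists
      refine hT2.trans ?_
      rw [Finset.sum_filter]
      refine Finset.sum_le_sum fun b _ => ?_
      by_cases hb : gap mean b = 0
      · simp [hb, hu1 b hb]
      · simp only [ne_eq, hb, not_false_eq_true, if_true]
        have := hT1 b
        simp only [α', hb, if_false] at this
        gcongr
  have h2 : ∑ b, (x b + ε) * (gap mean b / 3) ≤ 2 * B := by
    calc _ = ∑ b, x b * (gap mean b / 3) + ε * G := by
          rw [hG, Finset.mul_sum, ← Finset.sum_add_distrib]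
          exact Finset.sum_congr rfl fun b _ => by ring
      _ ≤ B + B := by
          refine add_le_add hxQ.2.2 ?_
          rw [hε, div_mul_eq_mul_div, div_le_iff₀ (by positivity)]
          nlinarith
      _ = 2 * B := by ring
  -- The `64` in `B` is chosen so that this reads `optValue ≤ optValue / 2`.
  have h3 : optValue v mean ≤ 16 / c * (2 * B) := h1.trans (by gcongr)
  have h4 : 16 / c * (2 * B) = optValue v mean / 2 := by
    rw [hB]; field_simp; norm_num
  linarith

/-! ### The optimal value for standard basis features. -/

theorem designMatrix_single (α : Fin K → ℝ) :
    designMatrix (fun a => Pi.single a 1) α = Matrix.diagonal α := by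
  ext i j
  simp only [designMatrix, Matrix.sum_apply, Matrix.smul_apply, Matrix.vecMulVec_apply,
    Matrix.diagonal_apply, smul_eq_mul, Pi.single_apply]
  by_cases hij : i = j
  · subst hij; simp
  · simp [hij]

/-- The optimal value of the `K`-armed bandit with a unique best arm. -/
theorem le_optValue_single (hK : 2 ≤ K) {mean : Fin K → ℝ} {a₀ : Fin K}
    (ha₀ : ∀ a, a ≠ a₀ → mean a < mean a₀) :
    K / (3 * ⨆ a, gap mean a) ≤ optValue (fun a : Fin K => Pi.single a 1) mean := by
  have hgap : ∀ a, a ≠ a₀ → 0 < gap mean a := fun a ha =>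
    sub_pos.2 ((ha₀ a ha).trans_le (le_ciSup (Set.finite_range mean).bddAbove a₀))
  have hsup : ∀ a, gap mean a ≤ ⨆ a, gap mean a := fun a =>
    le_ciSup (Set.finite_range (gap mean)).bddAbove a
  have hwidth : ∀ (α : Fin K → ℝ), (∀ a, 0 < α a) → ∀ a, (Pi.single a 1 : Fin K → ℝ) ⬝ᵥ
      ((designMatrix (fun a => Pi.single a 1) α)⁻¹ *ᵥ Pi.single a 1) = (α a)⁻¹ := by
    intro α hα a
    have h1 : (Matrix.diagonal α)⁻¹ = Matrix.diagonal fun a => (α a)⁻¹ :=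
      Matrix.inv_eq_right_inv (by
        rw [Matrix.diagonal_mul_diagonal, ← Matrix.diagonal_one]
        exact congrArg _ (funext fun a => mul_inv_cancel₀ (hα a).ne'))
    rw [designMatrix_single, h1]
    simp
  refine le_csInf ?_ ?_
  -- A feasible point is needed because the infimum of the empty set is zero by convention.
  · let α : Fin K → ℝ := fun a => if a = a₀ then 1 else 2 / gap mean a ^ 2
    have hα : ∀ a, 0 < α a := fun a => by
      by_cases ha : a = a₀
      · simp [α, ha]
      · have := hgap a ha
        simp only [α, ha, if_false]; positivity
    refine ⟨_, α, ⟨fun a => (hα a).le, ?_, fun a ha => ?_⟩, rfl⟩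
    · rw [designMatrix_single]
      exact Matrix.posDef_diagonal_iff.2 hα
    · rw [hwidth α hα]
      by_cases ha' : a = a₀
      · have : Nonempty (Fin K) := ⟨a₀⟩
        refine absurd (sub_nonpos.2 (ciSup_le fun i => ?_)) (not_le.2 ha)
        rw [ha']
        by_cases hi : i = a₀
        · rw [hi]
        · exact (ha₀ i hi).le
      · simp [α, ha']
  · rintro y ⟨α, hα, rfl⟩
    have hpos : ∀ a, 0 < α a := by
      have := hα.posDef
      rw [designMatrix_single] at this
      exact Matrix.posDef_diagonal_iff.1 this
    set G := ⨆ a, gap mean a with hG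
    have hterm : ∀ a, a ≠ a₀ → 2 / (3 * G) ≤ α a * (gap mean a / 3) := fun a ha => by
      have h1 := hgap a ha
      have h2 := hα.width_le a h1
      rw [hwidth α hpos, inv_le_comm₀ (hpos a) (by positivity)] at h2
      calc 2 / (3 * G) ≤ 2 / (3 * gap mean a) := by gcongr; exact hsup a
        _ = (gap mean a ^ 2 / 2)⁻¹ * (gap mean a / 3) := by field_simp
        _ ≤ _ := by gcongr
    have hG0 : 0 ≤ G := (gap_nonneg mean a₀).trans (hsup a₀)
    have hK' : (2 : ℝ) ≤ K := by exact_mod_cast hK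
    -- Since `2 ≤ K`, the `K - 1` suboptimal arms contribute at least `K / 2` terms.
    calc (K : ℝ) / (3 * G) ≤ (K - 1) * (2 / (3 * G)) := by
          rw [mul_div_assoc', div_eq_mul_inv, div_eq_mul_inv]
          gcongr
          linarith
      _ = ∑ a ∈ Finset.univ.erase a₀, 2 / (3 * G) := by
          rw [Finset.sum_const, Finset.card_erase_of_mem (Finset.mem_univ _), Finset.card_univ,
            Fintype.card_fin, nsmul_eq_mul, Nat.cast_sub (by omega), Nat.cast_one]
      _ ≤ ∑ a ∈ Finset.univ.erase a₀, α a * (gap mean a / 3) :=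
          Finset.sum_le_sum fun a ha => hterm a (Finset.ne_of_mem_erase ha)
      _ ≤ _ := Finset.sum_le_univ_sum_of_nonneg fun a =>
          mul_nonneg (hpos a).le (by linarith [gap_nonneg mean a])

/-! ### Good pulls and the compensation they require. -/

/-- Arm `b` is pulled in round `t`, the noise of all arms is controlled at level `U`, and both `b`
and some optimal arm have been pulled at least `n` times. -/
def goodPull (mean : Fin K → ℝ) (U : ℝ) (n t : ℕ) (b : Fin K) : Set (ℕ → Fin K × ℝ) :=
  {h | (h t).1 = b ∧ (∀ a, noiseSum mean a t h ^ 2 ≤ U * pulls a t h) ∧ n ≤ pulls b t h ∧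
    ∃ i, gap mean i = 0 ∧ n ≤ pulls i t h}

theorem measurableSet_goodPull (mean : Fin K → ℝ) (U : ℝ) (n t : ℕ) (b : Fin K) :
    MeasurableSet (goodPull mean U n t b) := by
  have hp : ∀ b : Fin K, Measurable fun h : ℕ → Fin K × ℝ => (pulls b t h : ℝ) := fun b =>
    measurable_from_top.comp (measurable_pulls b t)
  have hn : ∀ b : Fin K, MeasurableSet {h : ℕ → Fin K × ℝ | n ≤ pulls b t h} := fun b =>
    measurableSet_le measurable_const (measurable_pulls b t)
  have h1 : goodPull mean U n t b = {h | (h t).1 = b} ∩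
      ((⋂ a, {h | noiseSum mean a t h ^ 2 ≤ U * pulls a t h}) ∩ ({h | n ≤ pulls b t h} ∩
        ⋃ i, ({_h | gap mean i = 0} ∩ {h | n ≤ pulls i t h}))) := by
    ext h; simp [goodPull]
  rw [h1]
  refine (measurableSet_arm t b).inter ((MeasurableSet.iInter fun a => ?_).inter
    ((hn b).inter (MeasurableSet.iUnion fun i => (MeasurableSet.const _).inter (hn i))))
  exact measurableSet_le ((measurable_noiseSum mean a t).pow_const 2) ((hp a).const_mul U)

/-- A good pull of a suboptimal arm requires a compensation of a third of its gap. -/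
theorem gap_div_three_le {x : Fin K → Fin d → ℝ} {θ θhat : Fin d → ℝ} {lam : ℝ} (hlam : 0 ≤ lam)
    {h : ℕ → Fin K × ℝ} {t n : ℕ} (hls : IsLeastSquares lam x h t θhat) {c : Fin K → ℝ}
    (hc : ∀ i, 0 ≤ c i)
    (hch : ∀ i, x i ⬝ᵥ θhat + c i ≤ x (h t).1 ⬝ᵥ θhat + c (h t).1) {U : ℝ} (hU : 0 ≤ U)
    (hn : 0 < n) {b : Fin K}
    (hR : 9 * (4 * K * U + 2 * (lam * (θ ⬝ᵥ θ))) ≤ n * gap (fun a => x a ⬝ᵥ θ) b ^ 2)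
    (hgood : h ∈ goodPull (fun a => x a ⬝ᵥ θ) U n t b) :
    gap (fun a => x a ⬝ᵥ θ) b / 3 ≤ c b := by
  obtain ⟨h1, h2, h3, i, h4, h5⟩ := hgood
  set Δ := gap (fun a => x a ⬝ᵥ θ) b with hΔ
  have hn' : (0 : ℝ) < n := by exact_mod_cast hn
  have herr : ∀ a, n ≤ pulls a t h → |x a ⬝ᵥ θhat - x a ⬝ᵥ θ| ≤ Δ / 3 := fun a ha => by
    have h6 := hls.pulls_mul_sq_le hlam θ hU h2 a
    refine abs_le_of_sq_le_sq ?_ (by linarith [gap_nonneg (fun a => x a ⬝ᵥ θ) b])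
    have h7 : (n : ℝ) * (x a ⬝ᵥ θhat - x a ⬝ᵥ θ) ^ 2 ≤ n * (Δ / 3) ^ 2 := by
      have h8 : (n : ℝ) ≤ pulls a t h := by exact_mod_cast ha
      calc _ ≤ pulls a t h * (x a ⬝ᵥ θhat - x a ⬝ᵥ θ) ^ 2 := by gcongr
        _ ≤ _ := by linarith
    exact le_of_mul_le_mul_left h7 hn'
  have h6 := abs_le.1 (herr b h3)
  have h7 := abs_le.1 (herr i h5)
  have h8 := hch i
  rw [h1] at h8
  have h9 : x i ⬝ᵥ θ - x b ⬝ᵥ θ = Δ := by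
    have : Δ - gap (fun a => x a ⬝ᵥ θ) i = x i ⬝ᵥ θ - x b ⬝ᵥ θ := by rw [hΔ]; unfold gap; ring
    rw [← this, h4, sub_zero]
  linarith [hc i]

/-- The total compensation is bounded below by the expected number of good pulls. -/
theorem IsIncentivizedRun.le_totalCompensation {Ω : Type*} [MeasurableSpace Ω] {μ : Measure Ω}
    [IsProbabilityMeasure μ] {π : Policy K} {x : Fin K → Fin d → ℝ} {θ : Fin d → ℝ} {σ2 : ℝ≥0}
    {lam : ℝ} (hlam : 0 ≤ lam) {h : Ω → ℕ → Fin K × ℝ} {θhat : ℕ → Ω → Fin d → ℝ}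
    {c : ℕ → Ω → Fin K → ℝ} (hrun : IsIncentivizedRun μ π x θ σ2 lam h θhat c)
    {mean : Fin K → ℝ} (hmean : (fun a => x a ⬝ᵥ θ) = mean) {U : ℝ}
    (hU : 0 ≤ U) {n : ℕ} (hn : 0 < n)
    (hR : ∀ b, 0 < gap mean b →
      9 * (4 * K * U + 2 * (lam * (θ ⬝ᵥ θ))) ≤ n * gap mean b ^ 2) (T : ℕ) :
    ENNReal.ofReal (∑ b, (∑ t ∈ Finset.range T,
      (π.law mean σ2).real (goodPull mean U n t b)) * (gap mean b / 3)) ≤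
      totalCompensation μ h c T := by
  have hg3 : ∀ b, 0 ≤ gap mean b / 3 := fun b => by linarith [gap_nonneg mean b]
  have h0 : ∑ b, (∑ t ∈ Finset.range T,
      (π.law mean σ2).real (goodPull mean U n t b)) * (gap mean b / 3) =
      ∑ t ∈ Finset.range T, ∑ b, gap mean b / 3 *
        (π.law mean σ2).real (goodPull mean U n t b) := by
    rw [Finset.sum_comm]
    exact Finset.sum_congr rfl fun b _ => by rw [mul_comm, Finset.mul_sum]
  rw [h0, totalCompensation, ENNReal.ofReal_sum_of_nonneg fun t _ => Finset.sum_nonneg fun b _ =>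
    mul_nonneg (hg3 b) measureReal_nonneg]
  refine Finset.sum_le_sum fun t _ => ?_
  rw [ENNReal.ofReal_sum_of_nonneg fun b _ => mul_nonneg (hg3 b) measureReal_nonneg]
  have h1 : ∀ b, ENNReal.ofReal (gap mean b / 3 *
      (π.law mean σ2).real (goodPull mean U n t b)) =
      ∫⁻ ω, (h ⁻¹' goodPull mean U n t b).indicator
        (fun _ => ENNReal.ofReal (gap mean b / 3)) ω ∂μ := fun b => by
    rw [lintegral_indicator_const (hrun.measurable_run (measurableSet_goodPull _ _ _ _ _)),
      ENNReal.ofReal_mul (hg3 b), ofReal_measureReal, ← hmean, ← hrun.law_run,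
      Measure.map_apply hrun.measurable_run (measurableSet_goodPull _ _ _ _ _)]
  simp only [h1]
  rw [← lintegral_finsetSum _ fun b _ => measurable_const.indicator
    (hrun.measurable_run (measurableSet_goodPull _ _ _ _ _))]
  refine lintegral_mono_ae ?_
  filter_upwards [hrun.comp_nonneg, hrun.least_squares, hrun.user_choice] with ω hc hls hch
  rw [Finset.sum_eq_single_of_mem (h ω t).1 (Finset.mem_univ _)]
  · by_cases hm : ω ∈ h ⁻¹' goodPull mean U n t (h ω t).1
    · rw [Set.indicator_of_mem hm]
      refine ENNReal.ofReal_le_ofReal ?_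
      rcases (gap_nonneg mean (h ω t).1).eq_or_lt with h2 | h2
      · rw [← h2, zero_div]; exact hc t _
      · subst hmean
        exact gap_div_three_le hlam (hls t) (hc t) (hch t) hU hn (hR _ h2) hm
    · rw [Set.indicator_of_notMem hm]
      exact zero_le
  · intro b _ hb
    exact Set.indicator_of_notMem (fun hm => hb hm.1.symm) _

theorem pulls_mono (b : Fin K) (h : ℕ → Fin K × ℝ) : Monotone fun t => pulls b t h :=
  monotone_nat_of_le_succ fun t => by rw [pulls_succ]; omega

/-- If the noise is controlled and suboptimal arms are rarely pulled initially, all but few of the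
pulls are good. -/
theorem pulls_le_card_goodPull {mean : Fin K → ℝ} {U : ℝ} {n T : ℕ} {h : ℕ → Fin K × ℝ}
    (h1 : ∀ t ≤ T, ∀ b, noiseSum mean b t h ^ 2 ≤ U * pulls b t h)
    (h2 : ∑ b ∈ Finset.univ.filter (fun b => gap mean b ≠ 0), (pulls b (2 * K * n) h : ℝ) <
      ((2 * K * n : ℕ) : ℝ) / 2) (b : Fin K) :
    (pulls b T h : ℝ) - ((2 * K + 1) * n : ℕ) ≤
      ∑ t ∈ Finset.range T, (goodPull mean U n t b).indicator 1 h := by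
  classical
  -- Pigeonhole: optimal arms take more than `K * n` of the first `2 * K * n` rounds, so one of them
  -- has at least `n` pulls.
  have h3 : ∃ i, gap mean i = 0 ∧ n ≤ pulls i (2 * K * n) h := by
    by_contra! hcon
    have h4 : ∑ b, (pulls b (2 * K * n) h : ℝ) = (2 * K * n : ℕ) := by
      exact_mod_cast sum_pulls _ h
    rw [← Finset.sum_filter_add_sum_filter_not _ (fun b => gap mean b ≠ 0)] at h4
    have h5 : ∑ b ∈ Finset.univ.filter (fun b => ¬ gap mean b ≠ 0),
        (pulls b (2 * K * n) h : ℝ) ≤ K * n := by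
      refine (Finset.sum_le_card_nsmul _ _ (n : ℝ) fun b hb => ?_).trans ?_
      · have : gap mean b = 0 := by simpa using hb
        exact_mod_cast (hcon b this).le
      · rw [nsmul_eq_mul]
        gcongr
        simpa using Finset.card_filter_le (Finset.univ : Finset (Fin K)) _
    push_cast at h2 h4
    linarith
  obtain ⟨i, hi0, hi⟩ := h3
  -- A pull that is not good is among the first `n` pulls of `b` or within the first `2 * K * n`
  -- rounds.
  have h4 : (pulls b T h : ℝ) ≤ ∑ t ∈ Finset.range T, ((goodPull mean U n t b).indicator 1 h +
      (if (h t).1 = b ∧ pulls b t h < n then 1 else 0) +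
      if t < 2 * K * n then 1 else 0) := by
    have hcast : (pulls b T h : ℝ) = ∑ t ∈ Finset.range T, if (h t).1 = b then 1 else 0 := by
      unfold pulls; push_cast; rfl
    rw [hcast]
    refine Finset.sum_le_sum fun t ht => ?_
    have hind : (0 : ℝ) ≤ (goodPull mean U n t b).indicator 1 h :=
      Set.indicator_nonneg (fun _ _ => zero_le_one) _
    have h5 : (0 : ℝ) ≤ if (h t).1 = b ∧ pulls b t h < n then 1 else 0 := by
      split_ifs <;> norm_num
    have h6 : (0 : ℝ) ≤ if t < 2 * K * n then 1 else 0 := by split_ifs <;> norm_num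
    by_cases hb : (h t).1 = b
    · rw [if_pos hb]
      by_cases hlt : pulls b t h < n
      · rw [if_pos ⟨hb, hlt⟩]
        linarith
      · by_cases htt : t < 2 * K * n
        · rw [if_pos htt]
          linarith
        · have hm : h ∈ goodPull mean U n t b :=
            ⟨hb, h1 t (Finset.mem_range.1 ht).le, not_lt.1 hlt, i, hi0,
              hi.trans (pulls_mono i h (not_lt.1 htt))⟩
          rw [Set.indicator_of_mem hm, Pi.one_apply]
          linarith
    · rw [if_neg hb]
      linarith
  rw [Finset.sum_add_distrib, Finset.sum_add_distrib] at h4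
  have h5 : ∑ t ∈ Finset.range T, (if (h t).1 = b ∧ pulls b t h < n then (1 : ℝ) else 0) ≤ n := by
    have := (sum_ite_pulls_lt b n T h).trans_le (min_le_right _ _)
    exact_mod_cast this
  have h6 : ∑ t ∈ Finset.range T, (if t < 2 * K * n then (1 : ℝ) else 0) ≤ (2 * K * n : ℕ) := by
    rw [Finset.sum_boole]
    have : ((Finset.range T).filter fun t => t < 2 * K * n).card ≤ 2 * K * n := by
      refine (Finset.card_le_card fun t ht => ?_).trans_eq (Finset.card_range (2 * K * n))
      exact Finset.mem_range.2 (Finset.mem_filter.1 ht).2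
    exact_mod_cast this
  push_cast at h6 ⊢
  linarith

/-! ### Growth rates: `level` is negligible against `scale`, and `scale` against `log T`. -/

/-- The number of pulls after which estimates are accurate: of smaller order than `log T`. -/
def scale (T : ℕ) : ℕ := ⌈√(Real.log T)⌉₊

/-- The level at which noise is controlled up to round `T`. -/
def level (T : ℕ) : ℝ := 2 * Real.log (Real.log T)

theorem tendsto_log_natCast : Tendsto (fun T : ℕ => Real.log T) atTop atTop :=
  Real.tendsto_log_atTop.comp tendsto_natCast_atTop_atTop

theorem tendsto_level : Tendsto level atTop atTop :=
  (Real.tendsto_log_atTop.comp tendsto_log_natCast).const_mul_atTop two_pos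

theorem tendsto_scale : Tendsto scale atTop atTop :=
  tendsto_nat_ceil_atTop.comp (Real.tendsto_sqrt_atTop.comp tendsto_log_natCast)

/-- Makes the pulls that are not good negligible against the forced exploration. -/
theorem isLittleO_scale :
    (fun T => (scale T : ℝ)) =o[atTop] fun T : ℕ => Real.log T := by
  have h1 : (fun x : ℝ => √x + 1) =o[atTop] fun x : ℝ => x := by
    refine IsLittleO.add ?_ (isLittleO_const_id_atTop 1)
    refine isLittleO_of_tendsto' ?_ ?_
    · filter_upwards [eventually_gt_atTop 0] with x hx h0
      exact absurd h0 hx.ne'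
    · simp only [Real.sqrt_div_self']
      exact tendsto_const_nhds.div_atTop Real.tendsto_sqrt_atTop
  refine IsBigO.trans_isLittleO ?_ (h1.comp_tendsto tendsto_log_natCast)
  refine IsBigO.of_bound 1 (.of_forall fun T => ?_)
  simp only [Function.comp_apply, one_mul, Real.norm_eq_abs]
  rw [abs_of_nonneg (by positivity), abs_of_nonneg (by positivity)]
  exact (Nat.ceil_lt_add_one (Real.sqrt_nonneg _)).le

/-- Makes `scale T` pulls enough to bring the estimation error below a third of any fixed positive
gap. -/
theorem isLittleO_level : level =o[atTop] fun T => (scale T : ℝ) := by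
  have h1 : (fun x : ℝ => 2 * Real.log x) =o[atTop] fun x : ℝ => √x := by
    simpa [Real.sqrt_eq_rpow] using
      (isLittleO_log_rpow_atTop (show (0 : ℝ) < 1 / 2 by norm_num)).const_mul_left 2
  refine (h1.comp_tendsto tendsto_log_natCast).trans_isBigO ?_
  refine IsBigO.of_bound 1 (.of_forall fun T => ?_)
  simp only [Function.comp_apply, one_mul, Real.norm_eq_abs]
  rw [abs_of_nonneg (by positivity), abs_of_nonneg (by positivity)]
  exact Nat.le_ceil _

/-- The union bound over arms and dyadic scales costs order `log T`, which `exp (-level T) = (log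
T)⁻²` absorbs. -/
theorem tendsto_log_mul_exp_neg_level (C : ℝ) :
    Tendsto (fun T : ℕ => C * (Nat.log 2 T + 1) * Real.exp (-level T)) atTop (𝓝 0) := by
  have h1 : Tendsto (fun x : ℝ => (1 / Real.log 2) * x⁻¹ + x⁻¹ * x⁻¹) atTop (𝓝 0) := by
    simpa using (tendsto_inv_atTop_zero.const_mul (1 / Real.log 2)).add
      (tendsto_inv_atTop_zero (𝕜 := ℝ).mul tendsto_inv_atTop_zero)
  have h2 : Tendsto (fun T : ℕ => (Nat.log 2 T + 1 : ℝ) * Real.exp (-level T)) atTop (𝓝 0) := by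
    refine squeeze_zero' (.of_forall fun T => by positivity) ?_ (h1.comp tendsto_log_natCast)
    filter_upwards [tendsto_log_natCast.eventually_gt_atTop 0] with T hT
    have h3 : Real.exp (-level T) = (Real.log T)⁻¹ * (Real.log T)⁻¹ := by
      rw [level, Real.exp_neg, two_mul, Real.exp_add, Real.exp_log hT, mul_inv]
    have h4 : (Nat.log 2 T : ℝ) ≤ Real.log T / Real.log 2 := by
      have := Real.natLog_le_logb T 2
      simpa [Real.logb] using this
    rw [h3]
    calc _ ≤ (Real.log T / Real.log 2 + 1) * ((Real.log T)⁻¹ * (Real.log T)⁻¹) := by gcongr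
      _ = _ := by simp only [Function.comp_apply]; field_simp
  simpa [mul_assoc] using h2.const_mul C

/-! ### Assembly of the lower bounds. -/

/-- Good pulls eventually collect logarithmic energy along each confusing direction. -/
theorem Policy.eventually_energy (π : Policy K) {v : Fin K → Fin d → ℝ} {σ2 : ℝ≥0} (hσ : 0 < σ2)
    (hπ : π.IsConsistent v σ2) (θ : Fin d → ℝ) {mean : Fin K → ℝ}
    (hmean : (fun a => v a ⬝ᵥ θ) = mean) {a : Fin K} (ha : 0 < gap mean a) {u : Fin d → ℝ}
    (hu : ∀ b, gap mean b = 0 → v b ⬝ᵥ u = 0) (hau : v a ⬝ᵥ u = 2 * gap mean a) :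
    ∀ᶠ T : ℕ in atTop, σ2 / 8 ≤ ∑ b, (∑ t ∈ Finset.range T, (π.law mean σ2).real
      (goodPull mean (4 * σ2 * level T) (scale T) t b)) / Real.log T * (v b ⬝ᵥ u) ^ 2 := by
  have hσ' : (0 : ℝ) < σ2 := hσ
  set S : Finset (Fin K) := Finset.univ.filter fun b => gap mean b ≠ 0 with hS
  obtain ⟨b₀, hb₀S, hb₀⟩ := Finset.exists_min_image S (gap mean) ⟨a, by simp [hS, ha.ne']⟩
  have hg : 0 < gap mean b₀ :=
    lt_of_le_of_ne (gap_nonneg _ _) (Ne.symm (by simpa [hS] using hb₀S))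
  set mean' : Fin K → ℝ := fun b => v b ⬝ᵥ (θ + u) with hmean'
  have hmm : ∀ b, mean' b = mean b + v b ⬝ᵥ u := fun b => by
    rw [hmean', ← hmean]; exact dotProduct_add _ _ _
  -- Optimal arms keep their means while arm `a` rises to one gap above the old optimum.
  have hgap' : ∀ b ∉ S, gap mean a ≤ gap mean' b := fun b hb => by
    have hb0 : gap mean b = 0 := by simpa [hS] using hb
    have h1 : mean' a ≤ ⨆ i, mean' i := le_ciSup (Set.finite_range mean').bddAbove a
    rw [hmm, hau] at h1
    have h2 : gap mean' b = (⨆ i, mean' i) - (mean b + v b ⬝ᵥ u) := by rw [gap, hmm]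
    rw [h2, hu b hb0]
    unfold gap at hb0 h1 ⊢
    linarith
  have hreg : (fun T => π.regret mean σ2 T) =o[atTop] fun T : ℕ => (T : ℝ) ^ (1 : ℝ) := by
    rw [← hmean]; exact hπ θ 1 one_pos le_rfl
  have hreg' : (fun T => π.regret mean' σ2 T) =o[atTop] fun T : ℕ => (T : ℝ) ^ (1 / 2 : ℝ) :=
    hπ (θ + u) (1 / 2) (by norm_num) (by norm_num)
  have hK : 0 < K := a.pos
  set P := π.law mean σ2 with hP
  have hP1 := π.tendsto_law_infoSum hσ.ne' hreg hreg' S hg hb₀ ha hgap'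
  have hP2 := (π.tendsto_law_suboptimal hreg S hg hb₀).comp
    (tendsto_scale.const_mul_atTop' (show 0 < 2 * K by omega))
  have hP3 := tendsto_log_mul_exp_neg_level (2 * K)
  have hP := (hP1.add hP2).add hP3
  rw [add_zero, add_zero] at hP
  set Z := ∑ b, (v b ⬝ᵥ u) ^ 2 with hZ
  have hZ0 : 0 ≤ Z := Finset.sum_nonneg fun b _ => sq_nonneg _
  have hscale := (isLittleO_scale.const_mul_left ((2 * K + 1) * Z)).bound
    (show (0 : ℝ) < σ2 / 4 by positivity)
  filter_upwards [hP.eventually_lt_const (show (0 : ℝ) < 1 / 2 by norm_num), hscale,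
    tendsto_level.eventually_gt_atTop 0, tendsto_log_natCast.eventually_gt_atTop 0]
    with T hT1 hT2 hT3 hT4
  set n := scale T with hn
  set U := 4 * σ2 * level T with hU
  let E1 : Set (ℕ → Fin K × ℝ) := {h | infoSum mean mean' σ2 T h < Real.log T / 2}
  let E2 : Set (ℕ → Fin K × ℝ) := {h | ((2 * K * n : ℕ) : ℝ) / 2 ≤
    ∑ b ∈ S, (pulls b (2 * K * n) h : ℝ)}
  let E3 : Set (ℕ → Fin K × ℝ) := {h | ∃ t ≤ T, ∃ b, U * pulls b t h < noiseSum mean b t h ^ 2}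
  let F : (ℕ → Fin K × ℝ) → ℝ := fun h => ∑ b, (v b ⬝ᵥ u) ^ 2 *
    ∑ t ∈ Finset.range T, (goodPull mean U n t b).indicator 1 h
  have hE3 : P.real E3 ≤ 2 * K * (Nat.log 2 T + 1) * Real.exp (-level T) :=
    ENNReal.toReal_le_of_le_ofReal (by positivity) (π.law_exists_sq_noiseSum mean hσ hT3 T)
  have hEc : 1 / 2 ≤ P.real (E1 ∪ E2 ∪ E3)ᶜ := by
    have h1 : P.real (E1 ∪ E2 ∪ E3) < 1 / 2 := by
      refine lt_of_le_of_lt ?_ hT1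
      refine (measureReal_union_le _ _).trans (add_le_add ((measureReal_union_le _ _).trans
        (add_le_add le_rfl ?_)) hE3)
      exact le_rfl
    have h2 := measureReal_union_le (μ := P) (E1 ∪ E2 ∪ E3) (E1 ∪ E2 ∪ E3)ᶜ
    rw [Set.union_compl_self, probReal_univ] at h2
    linarith
  -- Information `log T / 2` gives energy `σ2 / 2 * log T`; pulls that are not good remove at most
  -- half of it.
  have hF : ∀ h ∈ (E1 ∪ E2 ∪ E3)ᶜ, σ2 / 4 * Real.log T ≤ F h := by
    intro h hh
    simp only [Set.compl_union, Set.mem_inter_iff, Set.mem_compl_iff] at hh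
    obtain ⟨⟨h1, h2⟩, h3⟩ := hh
    have h1' : Real.log T / 2 ≤ infoSum mean mean' σ2 T h := not_lt.1 h1
    have h2' : ∑ b ∈ S, (pulls b (2 * K * n) h : ℝ) < ((2 * K * n : ℕ) : ℝ) / 2 := not_le.1 h2
    have h3' : ∀ t ≤ T, ∀ b, noiseSum mean b t h ^ 2 ≤ U * pulls b t h := fun t ht b =>
      not_lt.1 fun hlt => h3 ⟨t, ht, b, hlt⟩
    have h4 : infoSum mean mean' σ2 T h * σ2 = ∑ b, pulls b T h * (v b ⬝ᵥ u) ^ 2 := by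
      rw [infoSum, sum_arm h fun b => (mean b - mean' b) ^ 2 / (σ2 : ℝ), Finset.sum_mul]
      refine Finset.sum_congr rfl fun b _ => ?_
      rw [hmm]
      field_simp
      ring
    have h5 : ∑ b, (v b ⬝ᵥ u) ^ 2 * ((pulls b T h : ℝ) - ((2 * K + 1) * n : ℕ)) ≤ F h :=
      Finset.sum_le_sum fun b _ => mul_le_mul_of_nonneg_left
        (pulls_le_card_goodPull h3' h2' b) (sq_nonneg _)
    have h6 : ∑ b, (v b ⬝ᵥ u) ^ 2 * ((pulls b T h : ℝ) - ((2 * K + 1) * n : ℕ)) =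
        infoSum mean mean' σ2 T h * σ2 - (2 * K + 1) * Z * n := by
      rw [h4, hZ, Finset.mul_sum, Finset.sum_mul, ← Finset.sum_sub_distrib]
      refine Finset.sum_congr rfl fun b _ => ?_
      push_cast
      ring
    rw [Real.norm_of_nonneg (by positivity), Real.norm_of_nonneg hT4.le] at hT2
    have h7 : Real.log T / 2 * σ2 ≤ infoSum mean mean' σ2 T h * σ2 := by gcongr
    linarith
  have hgm := fun t b => measurableSet_goodPull mean U n t b
  have hint : ∀ b, ∀ t ∈ Finset.range T,
      Integrable ((goodPull mean U n t b).indicator (1 : (ℕ → Fin K × ℝ) → ℝ)) P := fun b t _ =>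
    (integrable_const (1 : ℝ)).indicator (hgm t b)
  have hF0 : ∀ h, 0 ≤ F h := fun h => Finset.sum_nonneg fun b _ => mul_nonneg (sq_nonneg _)
    (Finset.sum_nonneg fun t _ => Set.indicator_nonneg (fun _ _ => zero_le_one) _)
  have hFi : Integrable F P := integrable_finsetSum _ fun b _ =>
    (integrable_finsetSum _ (hint b)).const_mul _
  have hFint : ∫ h, F h ∂P = ∑ b, (v b ⬝ᵥ u) ^ 2 *
      ∑ t ∈ Finset.range T, P.real (goodPull mean U n t b) := by
    rw [integral_finsetSum _ fun b _ => (integrable_finsetSum _ (hint b)).const_mul _]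
    refine Finset.sum_congr rfl fun b _ => ?_
    rw [integral_const_mul, integral_finsetSum _ (hint b)]
    congr 1
    exact Finset.sum_congr rfl fun t _ => integral_indicator_one (hgm t b)
  -- Markov's inequality on an event of probability at least one half turns `σ2 / 4` into `σ2 / 8`.
  have hmark := mul_meas_ge_le_integral_of_nonneg (ae_of_all P hF0) hFi (σ2 / 4 * Real.log T)
  have h8 : σ2 / 4 * Real.log T * (1 / 2) ≤ ∫ h, F h ∂P :=
    le_trans (by gcongr; exact hEc.trans (measureReal_mono hF)) hmark
  have h9 : ∑ b, (∑ t ∈ Finset.range T, P.real (goodPull mean U n t b)) / Real.log T *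
      (v b ⬝ᵥ u) ^ 2 = (∫ h, F h ∂P) / Real.log T := by
    rw [hFint, Finset.sum_div]
    exact Finset.sum_congr rfl fun b _ => by ring
  rw [h9, le_div_iff₀ hT4]
  linarith

/-- The compensation lower bound in terms of the optimal value. -/
theorem eventually_le_totalCompensation {dv dx : ℕ} {σ2 : ℝ≥0} (hσ : 0 < σ2)
    {v : Fin K → Fin dv → ℝ} (hv : Submodule.span ℝ (Set.range v) = ⊤) {π : Policy K}
    (hπ : π.IsConsistent v σ2) (P : Matrix (Fin dx) (Fin dv) ℝ) (θx : Fin dx → ℝ) {lam : ℝ}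
    (hlam : 0 ≤ lam) {Ω : Type*} [MeasurableSpace Ω] (μ : Measure Ω) [IsProbabilityMeasure μ]
    {h : Ω → ℕ → Fin K × ℝ} {θhat : ℕ → Ω → Fin dx → ℝ} {c : ℕ → Ω → Fin K → ℝ}
    (hrun : IsIncentivizedRun μ π (fun a => P *ᵥ v a) θx σ2 lam h θhat c) :
    ∀ᶠ T : ℕ in atTop, ENNReal.ofReal
      (σ2 / 8 / 64 * (optValue v (fun a => v a ⬝ᵥ (Pᵀ *ᵥ θx)) * Real.log T)) ≤
        totalCompensation μ h c T := by
  have hσ' : (0 : ℝ) < σ2 := hσ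
  set mean : Fin K → ℝ := fun a => v a ⬝ᵥ (Pᵀ *ᵥ θx) with hmean
  have hmx : (fun a => (P *ᵥ v a) ⬝ᵥ θx) = mean := by
    funext a
    rw [hmean, Matrix.mulVec_transpose, dotProduct_comm, Matrix.dotProduct_mulVec,
      dotProduct_comm]
  let α : ℕ → Fin K → ℝ := fun T b => (∑ t ∈ Finset.range T, (π.law mean σ2).real
      (goodPull mean (4 * σ2 * level T) (scale T) t b)) / Real.log T
  have hα : ∀ T b, 0 ≤ α T b := fun T b => div_nonneg
    (Finset.sum_nonneg fun t _ => measureReal_nonneg) (Real.log_natCast_nonneg T)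
  have h1 := eventually_optValue_le hv (mean := mean) hα (c := σ2 / 8) (by positivity)
    fun a ha u hu hau => π.eventually_energy hσ hπ (Pᵀ *ᵥ θx) rfl ha hu hau
  have h2 : ∀ b, ∀ᶠ T : ℕ in atTop, 0 < gap mean b →
      9 * (4 * K * (4 * σ2 * level T) + 2 * (lam * (θx ⬝ᵥ θx))) ≤ scale T * gap mean b ^ 2 := by
    intro b
    by_cases hb : 0 < gap mean b
    · have h3 : (fun T => 9 * (4 * K * (4 * σ2 * level T) + 2 * (lam * (θx ⬝ᵥ θx)))) =o[atTop]
          fun T => (scale T : ℝ) := by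
        have h4 := isLittleO_level.const_mul_left (9 * (4 * K * (4 * σ2)))
        have h5 : (fun _ : ℕ => 9 * (2 * (lam * (θx ⬝ᵥ θx)))) =o[atTop]
            fun T => (scale T : ℝ) :=
          isLittleO_const_left.2 (Or.inr (tendsto_norm_atTop_atTop.comp
            (tendsto_natCast_atTop_atTop.comp tendsto_scale)))
        refine (h4.add h5).congr_left fun T => by ring
      filter_upwards [h3.bound (show 0 < gap mean b ^ 2 by positivity)] with T hT _
      rw [mul_comm (scale T : ℝ)]
      refine (le_abs_self _).trans (hT.trans_eq ?_)
      rw [Real.norm_of_nonneg (by positivity)]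
    · exact .of_forall fun T h0 => absurd h0 hb
  filter_upwards [h1, eventually_all.2 h2, tendsto_level.eventually_ge_atTop 0,
    tendsto_scale.eventually_gt_atTop 0, tendsto_log_natCast.eventually_gt_atTop 0]
    with T hT1 hT2 hT3 hT4 hT5
  refine le_trans (ENNReal.ofReal_le_ofReal ?_) (hrun.le_totalCompensation hlam hmx
    (U := 4 * σ2 * level T) (by positivity) hT4 hT2 T)
  calc _ = σ2 / 8 / 64 * optValue v mean * Real.log T := by ring
    _ ≤ (∑ b, α T b * (gap mean b / 3)) * Real.log T := by gcongr
    _ = _ := by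
      rw [Finset.sum_mul]
      refine Finset.sum_congr rfl fun b _ => ?_
      simp only [α]
      field_simp

theorem span_single_eq_top : Submodule.span ℝ
    (Set.range fun a : Fin K => (Pi.single a 1 : Fin K → ℝ)) = ⊤ := by
  have h := (Pi.basisFun ℝ (Fin K)).span_eq
  simpa [funext (Pi.basisFun_apply ℝ (Fin K))] using h

end InfoGap

end

theorem mainTheorem5 (σ2 : ℝ≥0) (hσ2 : 0 < σ2) :
    ∃ κ : ℝ, 0 < κ ∧
      -- the general lower bound
      (∀ (K dv dx : ℕ) (v : Fin K → Fin dv → ℝ),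
        Submodule.span ℝ (Set.range v) = ⊤ →
        ∀ π : InfoGap.Policy K, π.IsConsistent v σ2 →
        ∀ (P : Matrix (Fin dx) (Fin dv) ℝ) (θx : Fin dx → ℝ) (lam : ℝ), 0 ≤ lam →
        ∀ (Ω : Type*) [MeasurableSpace Ω] (μ : Measure Ω) [IsProbabilityMeasure μ]
          (h : Ω → ℕ → Fin K × ℝ) (θhat : ℕ → Ω → Fin dx → ℝ) (c : ℕ → Ω → Fin K → ℝ),
        InfoGap.IsIncentivizedRun μ π (fun a => P *ᵥ v a) θx σ2 lam h θhat c →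
        ∀ᶠ T : ℕ in atTop,
          ENNReal.ofReal
              (κ * (InfoGap.optValue v (fun a => v a ⬝ᵥ (Pᵀ *ᵥ θx)) * Real.log T)) ≤
            InfoGap.totalCompensation μ h c T) ∧
      -- the `K`-armed case: the system sees only the arm indices, `v_a = e_a` and `K = d_v`
      (∀ (dv dx : ℕ), 2 ≤ dv →
        ∀ π : InfoGap.Policy dv, π.IsConsistent (fun a => Pi.single a 1) σ2 →
        ∀ (P : Matrix (Fin dx) (Fin dv) ℝ) (θx : Fin dx → ℝ) (lam : ℝ), 0 ≤ lam →
        (∃ a₀, ∀ a, a ≠ a₀ → (Pᵀ *ᵥ θx) a < (Pᵀ *ᵥ θx) a₀) →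
        ∀ (Ω : Type*) [MeasurableSpace Ω] (μ : Measure Ω) [IsProbabilityMeasure μ]
          (h : Ω → ℕ → Fin dv × ℝ) (θhat : ℕ → Ω → Fin dx → ℝ) (c : ℕ → Ω → Fin dv → ℝ),
        InfoGap.IsIncentivizedRun μ π (fun a => P *ᵥ Pi.single a 1) θx σ2 lam h θhat c →
        ∀ᶠ T : ℕ in atTop,
          ENNReal.ofReal (κ * (dv * Real.log T / ⨆ a, InfoGap.gap (Pᵀ *ᵥ θx) a)) ≤
            InfoGap.totalCompensation μ h c T) := by
  have hσ' : (0 : ℝ) < σ2 := hσ2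
  -- The last factor `3` is the one in the basis-vector bound `K / (3 * max gap)`; the general case
  -- simply gives it away.
  refine ⟨σ2 / 8 / 64 / 3, by positivity, ?_, ?_⟩
  · intro K dv dx v hv π hπ P θx lam hlam Ω _ μ _ h θhat c hrun
    filter_upwards [InfoGap.eventually_le_totalCompensation hσ2 hv hπ P θx hlam μ hrun] with T hT
    refine le_trans ?_ hT
    set A := InfoGap.optValue v (fun a => v a ⬝ᵥ (Pᵀ *ᵥ θx)) * Real.log T
    rcases le_or_gt A 0 with hA | hA
    · rw [ENNReal.ofReal_of_nonpos (mul_nonpos_of_nonneg_of_nonpos (by positivity) hA)]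
      exact zero_le
    · refine ENNReal.ofReal_le_ofReal (mul_le_mul_of_nonneg_right ?_ hA.le)
      exact div_le_self (by positivity) (by norm_num)
  · intro dv dx hdv π hπ P θx lam hlam ⟨a₀, ha₀⟩ Ω _ μ _ h θhat c hrun
    have hm : (fun a : Fin dv => Pi.single a 1 ⬝ᵥ (Pᵀ *ᵥ θx)) = Pᵀ *ᵥ θx := by
      funext a; exact single_one_dotProduct _ _
    have h1 := InfoGap.le_optValue_single hdv ha₀
    filter_upwards [InfoGap.eventually_le_totalCompensation hσ2 InfoGap.span_single_eq_top hπ P θx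
      hlam μ hrun] with T hT
    refine le_trans (ENNReal.ofReal_le_ofReal ?_) hT
    rw [hm]
    have hlog := Real.log_natCast_nonneg T
    calc _ = σ2 / 8 / 64 * (dv / (3 * ⨆ a, InfoGap.gap (Pᵀ *ᵥ θx) a) * Real.log T) := by
          rw [← div_div]; ring
      _ ≤ _ := by gcongr
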